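/- Let $R$ be a commutative artinian ring, let $I$ be an injective envelope of the $R$-module $R/\operatorname{rad}(R)$, and put $D=\operatorname{Hom}_R(-,I)$. Let $A$ be an artin $R$-algebra, i.e. an $R$-algebra which is finitely generated as an $R$-module. Let $\operatorname{Mod}A$ be the category of left $A$-modules and $\operatorname{mod}A$ its full subcategory of finitely generated modules. The dual $DA$ is an $A$-bimodule via $(af)(x)=f(xa)$ and $(fa)(x)=f(ax)$. Let $(\mathcal X,\mathcal Y)$ be a torsion theory for $\operatorname{mod}A$: $\mathcal X$ and $\mathcal Y$ are full subcategories of $\operatorname{mod}A$ with $\mathcal X\cap\mathcal Y=\{0\}$, $\mathcal X$ is closed under factor modules, $\mathcal Y$ is closed under (finitely generated) submodules, and every $M\in\operatorname{mod}A$ lies in an exact sequence $0\to M'\to M\to M''\to 0$ with $M'\in\mathcal X$ and $M''\in\mathcal Y$. Assume that * there is $X\in\mathcal X$ with $\operatorname{Ext}^1_A(X,\mathcal X)=0$ such that every module in $\mathcal X$ is an epimorphic image of a direct sum of copies of $X$; * there is $Y\in\mathcal Y$ with $\operatorname{Ext}^1_A(\mathcal Y,Y)=0$ such that every module in $\mathcal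 Y$ embeds into a direct product of copies of $Y$; * $DA\otimes_A M\in\mathcal X$ for all $M\in\mathcal X$. Let $P_1\xrightarrow{d}P_0\xrightarrow{\varepsilon}X\to0$ be a minimal projective presentation ($\varepsilon$ is a projective cover of $X$ and $d$ induces a projective cover $P_1\to\operatorname{Ker}\varepsilon$), and let $M_X^\bullet$ be the complex $P_1\xrightarrow{d}P_0$ with $P_1$ in degree $-1$ and $P_0$ in degree $0$. Let $0\to Y\xrightarrow{\eta}E_0\xrightarrow{\delta}E_1$ be a minimal injective presentation ($\eta$ is an injective envelope of $Y$ and $\delta$ induces an injective envelope $E_0/\operatorname{Im}\eta\to E_1$), and let $N_Y^\bullet$ be the complex $E_0\xrightarrow{\delta}E_1$ with $E_0$ in degree $0$ and $E_1$ in degree $1$. Put $$P^\bullet=M_X^\bullet\oplus\operatorname{Hom}^\bullet_A(DA,N_Y^\bullet)[1].$$ Then $P^\bullet$ is concentrated in degrees $-1$ and $0$, and it is a tilting complex: it is a bounded complex of finitely generated projective $A$-modules, $\operatorname{Hom}(P^\bullet,P^\bullet[i])=0$ in the homotopy category for all $i\ne0$, and $\operatorname{add}(P^\bullet)$ (the direct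 summands of finite direct sums of copies of $P^\bullet$) generates $K^b(\operatorname{proj}A)$ as a triangulated category. Moreover $\mathcal X=\mathcal X_c(P^\bullet)$ and $\mathcal Y=\mathcal Y_c(P^\bullet)$, where $$\mathcal X_c(P^\bullet)=\{M\in\operatorname{mod}A:\operatorname{Hom}_{D(\operatorname{Mod}A)}(P^\bullet,M[1])=0\},\qquad \mathcal Y_c(P^\bullet)=\{M\in\operatorname{mod}A:\operatorname{Hom}_{D(\operatorname{Mod}A)}(P^\bullet,M)=0\}.$$ -/

import Mathlib

open CategoryTheory CategoryTheory.Limits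
open scoped TensorProduct

universe w u

namespace ArtinTilting

section Covers

variable {R : Type u} [Ring R] {M N : Type u} [AddCommGroup M] [Module R M]
  [AddCommGroup N] [Module R N]

/-- `p : M → N` is a projective cover of `N`: `M` is projective, `p` is surjective and the kernel
of `p` is superfluous in `M`. -/
def IsProjectiveCover (p : M →ₗ[R] N) : Prop :=
  Module.Projective R M ∧ Function.Surjective p ∧
    ∀ L : Submodule R M, L ⊔ LinearMap.ker p = ⊤ → L = ⊤

/-- `j : M → N` is an injective envelope of `M`: `N` is injective, `j` is injective and the image
of `j` is essential in `N`. -/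
def IsInjectiveEnvelope (j : M →ₗ[R] N) : Prop :=
  Module.Injective R N ∧ Function.Injective j ∧
    ∀ L : Submodule R N, L ⊓ LinearMap.range j = ⊥ → L = ⊥

end Covers

section Modules

variable {A : Type u} [Ring A]

/-- `P₁ → P₀ → X → 0` is a minimal projective presentation: `ε` is a projective cover of `X` and
`d` induces a projective cover `P₁ → Ker ε`. -/
def IsMinimalProjectivePresentation {P₁ P₀ X : ModuleCat.{u} A} (d : P₁ ⟶ P₀) (ε : P₀ ⟶ X) :
    Prop :=
  IsProjectiveCover ε.hom ∧
    ∃ h : ∀ x, d.hom x ∈ LinearMap.ker ε.hom,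
      IsProjectiveCover (LinearMap.codRestrict (LinearMap.ker ε.hom) d.hom h)

/-- `0 → Y → E₀ → E₁` is a minimal injective presentation: `η` is an injective envelope of `Y` and
`δ` induces an injective envelope `E₀ / Im η → E₁`. -/
def IsMinimalInjectivePresentation {Y E₀ E₁ : ModuleCat.{u} A} (η : Y ⟶ E₀) (δ : E₀ ⟶ E₁) :
    Prop :=
  IsInjectiveEnvelope η.hom ∧
    ∃ h : LinearMap.range η.hom ≤ LinearMap.ker δ.hom,
      IsInjectiveEnvelope ((LinearMap.range η.hom).liftQ δ.hom h)

/-- A torsion theory `(𝒳, 𝒴)` for the category `mod A` of finitely generated left `A`-modules;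
full subcategories of `mod A` are given as properties of `A`-modules which imply finite
generation. -/
structure IsTorsionTheory (𝒳 𝒴 : ObjectProperty (ModuleCat.{u} A)) : Prop where
  finite_left : ∀ M, 𝒳 M → Module.Finite A M
  finite_right : ∀ M, 𝒴 M → Module.Finite A M
  inter : ∀ M, (𝒳 M ∧ 𝒴 M) ↔ IsZero M
  factor : ∀ {M N : ModuleCat.{u} A} (f : M ⟶ N), Epi f → 𝒳 M →
    Module.Finite A N → 𝒳 N
  sub : ∀ {M N : ModuleCat.{u} A} (f : M ⟶ N), Mono f → 𝒴 N →
    Module.Finite A M → 𝒴 M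
  exact : ∀ M : ModuleCat.{u} A, Module.Finite A M →
    ∃ (M' M'' : ModuleCat.{u} A) (i : M' ⟶ M) (p : M ⟶ M'') (h : i ≫ p = 0),
      (ShortComplex.mk i p h).ShortExact ∧ 𝒳 M' ∧ 𝒴 M''

/-- `X` is an `Ext`-projective object of the full subcategory `𝒞`. -/
def IsExtProjective (𝒞 : ObjectProperty (ModuleCat.{u} A)) (X : ModuleCat.{u} A) : Prop :=
  𝒞 X ∧ ∀ Z, 𝒞 Z → Subsingleton (Abelian.Ext.{u} X Z 1)

/-- `Y` is an `Ext`-injective object of the full subcategory `𝒞`. -/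
def IsExtInjective (𝒞 : ObjectProperty (ModuleCat.{u} A)) (Y : ModuleCat.{u} A) : Prop :=
  𝒞 Y ∧ ∀ Z, 𝒞 Z → Subsingleton (Abelian.Ext.{u} Z Y 1)

/-- `X` generates `𝒞`: each object of `𝒞` is an epimorphic image of a direct sum of copies
of `X`. -/
def Generates (X : ModuleCat.{u} A) (𝒞 : ObjectProperty (ModuleCat.{u} A)) : Prop :=
  ∀ M : ModuleCat.{u} A, 𝒞 M →
    ∃ (Λ : Type u) (f : (Λ →₀ X) →ₗ[A] M), Function.Surjective f

/-- `Y` cogenerates `𝒞`: each object of `𝒞` embeds into a direct product of copies of `Y`. -/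
def Cogenerates (Y : ModuleCat.{u} A) (𝒞 : ObjectProperty (ModuleCat.{u} A)) : Prop :=
  ∀ M : ModuleCat.{u} A, 𝒞 M →
    ∃ (Λ : Type u) (f : M →ₗ[A] (Λ → Y)), Function.Injective f

end Modules

section Dual

variable (R A I : Type u) [CommRing R] [Ring A] [Algebra R A] [AddCommGroup I] [Module R I]

/-- The dual `DA = Hom_R(A, I)`. -/
def Dual : Type u := A →ₗ[R] I

noncomputable instance : AddCommGroup (Dual R A I) :=
  inferInstanceAs (AddCommGroup (A →ₗ[R] I))

instance : FunLike (Dual R A I) A I := inferInstanceAs (FunLike (A →ₗ[R] I) A I)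

variable {R A I}

@[ext]
theorem Dual.ext {f g : Dual R A I} (h : ∀ x, f x = g x) : f = g := LinearMap.ext h

@[simp]
theorem Dual.add_apply (f g : Dual R A I) (x : A) : (f + g) x = f x + g x := rfl

@[simp]
theorem Dual.zero_apply (x : A) : (0 : Dual R A I) x = 0 := rfl

theorem Dual.map_add (f : Dual R A I) (x y : A) : f (x + y) = f x + f y :=
  LinearMap.map_add (show A →ₗ[R] I from f) x y

theorem Dual.map_zero (f : Dual R A I) : f 0 = 0 :=
  LinearMap.map_zero (show A →ₗ[R] I from f)

/-- The left action `(a f)(x) = f (x a)`. -/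
noncomputable instance : SMul A (Dual R A I) :=
  ⟨fun a f => (show A →ₗ[R] I from f) ∘ₗ LinearMap.mulRight R a⟩

/-- The right action `(f a)(x) = f (a x)`. -/
noncomputable instance : SMul Aᵐᵒᵖ (Dual R A I) :=
  ⟨fun a f => (show A →ₗ[R] I from f) ∘ₗ LinearMap.mulLeft R a.unop⟩

@[simp]
theorem Dual.smul_apply (a : A) (f : Dual R A I) (x : A) : (a • f) x = f (x * a) := rfl

@[simp]
theorem Dual.op_smul_apply (a : Aᵐᵒᵖ) (f : Dual R A I) (x : A) :
    (a • f) x = f (a.unop * x) := rfl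

noncomputable instance : Module A (Dual R A I) where
  one_smul f := by ext x; simp
  mul_smul a b f := by ext x; simp [mul_assoc]
  smul_zero a := by ext x; simp
  smul_add a f g := by ext x; simp
  add_smul a b f := by ext x; simp [mul_add, Dual.map_add]
  zero_smul f := by ext x; simp [Dual.map_zero]

noncomputable instance : Module Aᵐᵒᵖ (Dual R A I) where
  one_smul f := by ext x; simp
  mul_smul a b f := by ext x; simp [mul_assoc]
  smul_zero a := by ext x; simp
  smul_add a f g := by ext x; simp
  add_smul a b f := by ext x; simp [add_mul, Dual.map_add]
  zero_smul f := by ext x; simp [Dual.map_zero]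

instance : SMulCommClass A Aᵐᵒᵖ (Dual R A I) where
  smul_comm a b f := by ext x; simp [mul_assoc]

variable (R A I)

/-- The left `A`-module `DA ⊗_A M`: the quotient of `DA ⊗_ℤ M` by the relations
`f a ⊗ m = f ⊗ a m`. The relations are stable under the left action of `A` on `DA`, so that
their `A`-span is their additive span. -/
noncomputable def dualTensor (M : ModuleCat.{u} A) : ModuleCat.{u} A :=
  ModuleCat.of A ((Dual R A I ⊗[ℤ] M) ⧸ Submodule.span A
    {t : Dual R A I ⊗[ℤ] M | ∃ (f : Dual R A I) (a : A) (m : M),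
      t = (MulOpposite.op a • f) ⊗ₜ[ℤ] m - f ⊗ₜ[ℤ] (a • m)})

/-- The left action `(a g)(f) = g (f a)` on `Hom_A(DA, N)`. -/
noncomputable instance dualHomModule (N : Type u) [AddCommGroup N] [Module A N] :
    Module A (Dual R A I →ₗ[A] N) where
  smul a g :=
    { toFun := fun f => g (MulOpposite.op a • f)
      map_add' := fun f f' => by rw [smul_add, map_add]
      map_smul' := fun b f => by
        rw [← smul_comm b (MulOpposite.op a) f, map_smul, RingHom.id_apply] }
  one_smul g := by
    ext f
    change g (MulOpposite.op 1 • f) = g f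
    rw [MulOpposite.op_one, one_smul]
  mul_smul a b g := by
    ext f
    change g (MulOpposite.op (a * b) • f) = g (MulOpposite.op b • MulOpposite.op a • f)
    rw [MulOpposite.op_mul, mul_smul]
  smul_zero a := rfl
  smul_add a g h := rfl
  add_smul a b g := by
    ext f
    change g (MulOpposite.op (a + b) • f) = g (MulOpposite.op a • f) + g (MulOpposite.op b • f)
    rw [MulOpposite.op_add, add_smul, map_add]
  zero_smul g := by
    ext f
    change g (MulOpposite.op 0 • f) = 0
    rw [MulOpposite.op_zero, zero_smul, map_zero]

/-- The functor `Hom_A(DA, -)` on left `A`-modules. -/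
noncomputable def dualHom : ModuleCat.{u} A ⥤ ModuleCat.{u} A where
  obj N := ModuleCat.of A (Dual R A I →ₗ[A] N)
  map {N N'} φ := ModuleCat.ofHom
    { toFun := fun g => φ.hom ∘ₗ g
      map_add' := fun g h => LinearMap.comp_add g h φ.hom
      map_smul' := fun _ _ => rfl }

instance : (dualHom R A I).Additive where
  map_add := rfl

end Dual

section Complexes

variable (A : Type u) [Ring A]

/-- Complexes of left `A`-modules (cohomological grading). -/
abbrev Cpx := CochainComplex (ModuleCat.{u} A) ℤ

/-- The homotopy category `K(Mod A)`. -/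
abbrev K := HomotopyCategory (ModuleCat.{u} A) (ComplexShape.up ℤ)

variable {A}

/-- A complex regarded as an object of the homotopy category. -/
noncomputable abbrev toK (P : Cpx A) : K A :=
  (HomotopyCategory.quotient (ModuleCat.{u} A) (ComplexShape.up ℤ)).obj P

/-- Bounded complexes of finitely generated projective modules, that is, the objects of
`K^b(proj A)`. -/
def IsBoundedProj (P : Cpx A) : Prop :=
  (∃ a b : ℤ, ∀ i : ℤ, (i < a ∨ b < i) → IsZero (P.X i)) ∧
    ∀ i : ℤ, Module.Finite A (P.X i) ∧ Module.Projective A (P.X i)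

/-- `add P`: the direct summands of finite direct sums of copies of `P` in the homotopy
category. -/
def InAdd (P T : K A) : Prop :=
  ∃ n : ℕ, Nonempty (Retract T (⨁ fun _ : Fin n => P))

/-- Tilting complexes in the sense of Rickard: `P` belongs to `K^b(proj A)`,
`Hom(P, P[i]) = 0` for `i ≠ 0`, and `add P` generates `K^b(proj A)` as a triangulated category. -/
structure IsTiltingComplex (P : Cpx A) : Prop where
  boundedProj : IsBoundedProj P
  hom_eq_zero : ∀ i : ℤ, i ≠ 0 → ∀ f : toK P ⟶ (toK P)⟦i⟧, f = 0
  generates : ∀ S : ObjectProperty (K A), S.IsClosedUnderIsomorphisms → S.IsTriangulated →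
    (∀ T, InAdd (toK P) T → S T) → ∀ Q : Cpx A, IsBoundedProj Q → S (toK Q)

/-- `P` has term length two: it is concentrated in degrees `-1` and `0`. -/
def IsTwoTerm (P : Cpx A) : Prop :=
  ∀ i : ℤ, i ≠ -1 → i ≠ 0 → IsZero (P.X i)

variable [HasDerivedCategory.{w} (ModuleCat.{u} A)]

/-- `𝒳_c(P)`: the finitely generated modules `M` with `Hom(P, M[1]) = 0` in `D(Mod A)`. -/
def torsionClass (P : Cpx A) : ObjectProperty (ModuleCat.{u} A) := fun M =>
  Module.Finite A M ∧
    ∀ f : DerivedCategory.Q.obj P ⟶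
      ((DerivedCategory.singleFunctor (ModuleCat.{u} A) 0).obj M)⟦(1 : ℤ)⟧, f = 0

/-- `𝒴_c(P)`: the finitely generated modules `M` with `Hom(P, M) = 0` in `D(Mod A)`. -/
def torsionFreeClass (P : Cpx A) : ObjectProperty (ModuleCat.{u} A) := fun M =>
  Module.Finite A M ∧
    ∀ f : DerivedCategory.Q.obj P ⟶
      (DerivedCategory.singleFunctor (ModuleCat.{u} A) 0).obj M, f = 0

end Complexes

section Construction

variable (R A I : Type u) [CommRing R] [Ring A] [Algebra R A] [AddCommGroup I] [Module R I]

/-- The complex `M ⊕ Hom_A(DA, N)[1]`, where `M` is `P₁ → P₀` in degrees `-1, 0` and `N` is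
`E₀ → E₁` in degrees `0, 1`. -/
noncomputable def presentationComplex {P₁ P₀ E₀ E₁ : ModuleCat.{u} A} (d : P₁ ⟶ P₀)
    (δ : E₀ ⟶ E₁) : Cpx A :=
  (HomologicalComplex.double d (show (ComplexShape.up ℤ).Rel (-1) 0 by simp) : Cpx A) ⊞
    (((dualHom R A I).mapHomologicalComplex (ComplexShape.up ℤ)).obj
      (HomologicalComplex.double δ (show (ComplexShape.up ℤ).Rel 0 1 by simp)) : Cpx A)⟦(1 : ℤ)⟧

end Construction

end ArtinTilting

/-! Write `a : U → V` for the differential of the complex, so `a` is the direct sum of `d` and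
`Hom_A(DA, δ)`. Since the terms are projective, the two classes of the complex are visible on `a`:
the first consists of the `M` such that every `U → M` extends along `a`, the second of the `M` such
that only the zero map `V → M` kills `a`. This and what is needed for tilting is collected in
`IsTiltingMap`.

The summand `d` is governed by `X`: maps `P₀ → M` killing `d` are maps `X → M`, and for `M` in `𝒳`
all maps `P₁ → M` extend, by the vanishing of Ext and minimality. The other summand is governed by
`Y` through Nakayama duality: a trace pairing identifies `Hom_A(M, E)` with the dual of
`Hom_A(Hom_A(DA, E), M)`. Thus extension along `Hom_A(DA, δ)` means injectivity of `Hom(M, δ)`, that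
is `Hom(M, Y) = 0`, and uniqueness follows from surjectivity of `Hom(M, δ)`, which holds on `𝒴`
(`forall_exists_comp_dualHomMap_iff`, `eq_zero_of_comp_dualHomMap_eq_zero`).

Selfextensions vanish because `Coker a` is in `𝒳` and `Ker a` is in `𝒴`. The former follows from
`Hom(Coker a, Y) = 0`; the latter from `Hom(X, Ker a) = 0`, where stability of `𝒳` under `DA ⊗ -`
enters (`IsTorsionTheory.isTiltingMap_prodMap`).

For generation, finitely many maps `U → B` generating `Hom(U, B)` define a universal extension `q`
of copies of `a` by a finitely generated projective `B`. The cokernel of `q` is again in `𝒳`, and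
this makes an approximation of `q` by copies of `a` split up to homotopy
(`IsTiltingMap.exists_retract`). So `B` lies in the triangulated subcategory, and bounded complexes
follow by induction on the number of terms. -/

namespace ArtinTilting

/-! ### Matlis duality over the artinian ring `R` -/

section Matlis

variable {R I : Type u} [CommRing R] [AddCommGroup I] [Module R I]
  {ι : (R ⧸ Ring.jacobson R) →ₗ[R] I}

/-- Elements of the injective envelope of `R / rad R` which are killed by a maximal ideal come from
`R / rad R`. -/
theorem IsInjectiveEnvelope.exists_eq_mk (hι : IsInjectiveEnvelope ι) (m : Ideal R)
    [hm : m.IsMaximal] (x : I) (hx : ∀ r ∈ m, r • x = 0) :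
    ∃ b : R, ι (Submodule.Quotient.mk b) = x ∧ ∀ r ∈ m, r * b ∈ Ring.jacobson R := by
  by_cases hx0 : x = 0
  · exact ⟨0, by rw [Submodule.Quotient.mk_zero, map_zero, hx0], by simp⟩
  have h : R ∙ x ⊓ LinearMap.range ι ≠ ⊥ := fun h => hx0 <| by
    have := hι.2.2 _ h
    rwa [Submodule.span_singleton_eq_bot] at this
  obtain ⟨y, ⟨hy1, hy2⟩, hy0⟩ := Submodule.exists_mem_ne_zero_of_ne_bot h
  obtain ⟨r, rfl⟩ := Submodule.mem_span_singleton.1 hy1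
  -- Essentiality gives a nonzero multiple `r • x` in the image. As `m` kills `x` and `r` is
  -- invertible modulo `m`, `x` is a multiple of `r • x`.
  have hr : r ∉ m := fun h => hy0 (hx r h)
  obtain ⟨s, hs⟩ := hm.exists_inv hr
  obtain ⟨t, ht, e⟩ := hs
  obtain ⟨z, hz⟩ := hy2
  obtain ⟨b, rfl⟩ := Submodule.Quotient.mk_surjective _ z
  have hsb : ι (Submodule.Quotient.mk (s * b)) = x := by
    have : (Submodule.Quotient.mk (s * b) : R ⧸ Ring.jacobson R) =
      s • Submodule.Quotient.mk b := rfl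
    rw [this, map_smul, hz, smul_smul]
    have h1 : (s * r + t) • x = x := by rw [e, one_smul]
    rwa [add_smul, hx t ht, add_zero] at h1
  refine ⟨s * b, hsb, fun r hr => ?_⟩
  rw [← Submodule.Quotient.mk_eq_zero (Ring.jacobson R)]
  apply hι.2.1
  rw [map_zero]
  have : (Submodule.Quotient.mk (r * (s * b)) : R ⧸ Ring.jacobson R) =
      r • Submodule.Quotient.mk (s * b) := rfl
  rw [this, map_smul, hsb, hx r hr]

theorem mem_jacobson_iff_forall_isMaximal (b : R) :
    b ∈ Ring.jacobson R ↔ ∀ m : Ideal R, m.IsMaximal → b ∈ m := by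
  rw [Ring.jacobson_eq_sInf_isMaximal, Submodule.mem_sInf]
  rfl

/-- The elements killed by a maximal ideal form a module generated by any nonzero element. -/
theorem IsInjectiveEnvelope.exists_smul_eq (hι : IsInjectiveEnvelope ι) (m : Ideal R)
    [hm : m.IsMaximal] {x y : I} (hx : ∀ r ∈ m, r • x = 0) (hy : ∀ r ∈ m, r • y = 0)
    (hx0 : x ≠ 0) : ∃ r : R, r • x = y := by
  obtain ⟨b, rfl, hb⟩ := hι.exists_eq_mk m x hx
  obtain ⟨c, rfl, hc⟩ := hι.exists_eq_mk m y hy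
  -- A class of `R / rad R` killed by `m` is concentrated at `m`: its representatives lie in all
  -- other maximal ideals. Hence these classes form a space of dimension at most one over `R / m`.
  have key : ∀ b : R, (∀ r ∈ m, r * b ∈ Ring.jacobson R) →
      ∀ m' : Ideal R, m'.IsMaximal → m' ≠ m → b ∈ m' := by
    intro b hb m' hm' hne
    obtain ⟨r, hr, hr'⟩ : ∃ r ∈ m, r ∉ m' := by
      by_contra! h
      exact hne (hm.eq_of_le hm'.ne_top h).symm
    exact ((hm'.isPrime.mem_or_mem ((mem_jacobson_iff_forall_isMaximal _).1 (hb r hr) m' hm'))).resolve_left hr'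
  have hbm : b ∉ m := by
    intro h
    apply hx0
    have : b ∈ Ring.jacobson R := by
      rw [mem_jacobson_iff_forall_isMaximal]
      intro m' hm'
      by_cases e : m' = m
      · rwa [e]
      · exact key b hb m' hm' e
    rw [(Submodule.Quotient.mk_eq_zero _).2 this, map_zero]
  obtain ⟨s, t, ht, e⟩ := hm.exists_inv hbm
  refine ⟨c * s, ?_⟩
  rw [← map_smul, ← Submodule.Quotient.mk_smul, smul_eq_mul]
  congr 1
  rw [Submodule.Quotient.eq, mem_jacobson_iff_forall_isMaximal]
  intro m' hm'
  by_cases h : m' = m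
  · subst h
    have : c * s * b - c = -(c * t) := by linear_combination c * e
    rw [this]
    exact m'.neg_mem (m'.mul_mem_left _ ht)
  · exact m'.sub_mem (m'.mul_mem_left _ (key b hb m' hm' h)) (key c hc m' hm' h)

/-- There are only finitely many maximal ideals, so some `b` outside `m` lies in all the others; the
class of `b` in `R / rad R` is nonzero and killed by `m`. -/
theorem IsInjectiveEnvelope.exists_ne_zero [IsArtinianRing R] (hι : IsInjectiveEnvelope ι) (m : Ideal R)
    [hm : m.IsMaximal] : ∃ x : I, x ≠ 0 ∧ ∀ r ∈ m, r • x = 0 := by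
  have hfin : {m : Ideal R | m.IsMaximal}.Finite := IsArtinianRing.setOfPred_isMaximal_finite R
  classical
  obtain ⟨b, hb, hbm⟩ : ∃ b, (∀ m' : Ideal R, m'.IsMaximal → m' ≠ m → b ∈ m') ∧ b ∉ m := by
    by_contra! h
    have h1 : (hfin.toFinset.erase m).inf id ≤ m := by
      intro b hb
      refine h b fun m' hm' hne => ?_
      simp only [Submodule.mem_finsetInf] at hb
      exact hb m' (by simp [hne, hm'])
    obtain ⟨m', hm', hle⟩ := (Ideal.IsPrime.inf_le' hm.isPrime).1 h1
    simp only [Finset.mem_erase, Set.Finite.mem_toFinset, Set.mem_ofPred_eq] at hm'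
    exact hm'.1 (hm'.2.eq_of_le hm.ne_top hle)
  refine ⟨ι (Submodule.Quotient.mk b), fun h => hbm ?_, fun r hr => ?_⟩
  · have := (Submodule.Quotient.mk_eq_zero _).1 (hι.2.1 (h.trans (map_zero ι).symm))
    exact (mem_jacobson_iff_forall_isMaximal b).1 this m hm
  · rw [← map_smul, ← Submodule.Quotient.mk_smul, (Submodule.Quotient.mk_eq_zero _).2, map_zero]
    rw [mem_jacobson_iff_forall_isMaximal]
    intro m' hm'
    by_cases e : m' = m
    · rw [e]; exact m.mul_mem_right _ hr
    · exact m'.mul_mem_left _ (hb m' hm' e)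

variable {M N : Type u} [AddCommGroup M] [Module R M] [AddCommGroup N] [Module R N]

/-- The injective envelope of `R / rad R` is a cogenerator. -/
theorem IsInjectiveEnvelope.exists_apply_ne_zero [IsArtinianRing R] (hι : IsInjectiveEnvelope ι) {y : M}
    (hy : y ≠ 0) : ∃ φ : M →ₗ[R] I, φ y ≠ 0 := by
  have hne : Ideal.torsionOf R M y ≠ ⊤ := by
    rwa [Ne, Ideal.torsionOf_eq_top_iff]
  obtain ⟨m, hm, hle⟩ := Ideal.exists_le_maximal _ hne
  -- The cyclic module `R ∙ y` has `R / m` as a quotient, and `R / m` maps to `I` by `1 ↦ x`;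
  -- injectivity of `I` extends the composite to `M`.
  obtain ⟨x, hx0, hx⟩ := hι.exists_ne_zero m
  let g : (R ∙ y) →ₗ[R] I :=
    ((Ideal.torsionOf R M y).liftQ (LinearMap.toSpanSingleton R I x) (fun r hr => by
      simpa using hx r (hle hr))) ∘ₗ (Ideal.quotTorsionOfEquivSpanSingleton R M y).symm.toLinearMap
  have hg : g ⟨y, Submodule.mem_span_singleton_self y⟩ = x := by
    have : (⟨y, Submodule.mem_span_singleton_self y⟩ : R ∙ y) =
        Ideal.quotTorsionOfEquivSpanSingleton R M y (Submodule.Quotient.mk 1) := by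
      rw [Ideal.quotTorsionOfEquivSpanSingleton_apply_mk]
      ext; simp
    simp only [g, LinearMap.comp_apply, LinearEquiv.coe_coe, this, LinearEquiv.symm_apply_apply,
      Submodule.liftQ_apply]
    simp
  obtain ⟨h, hh⟩ := hι.1.out (R ∙ y).subtype (Submodule.injective_subtype _) g
  refine ⟨h, ?_⟩
  have := hh ⟨y, Submodule.mem_span_singleton_self y⟩
  rw [hg] at this
  simp only [Submodule.subtype_apply] at this
  rwa [this]

theorem IsInjectiveEnvelope.exists_extension (hι : IsInjectiveEnvelope ι) (i : N →ₗ[R] M)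
    (hi : Function.Injective i) (g : N →ₗ[R] I) : ∃ h : M →ₗ[R] I, h ∘ₗ i = g := by
  obtain ⟨h, hh⟩ := hι.1.out i hi g
  exact ⟨h, LinearMap.ext hh⟩

/-- A linear form vanishing on a submodule and nonzero at a given vector outside it. -/
theorem IsInjectiveEnvelope.exists_separating [IsArtinianRing R] (hι : IsInjectiveEnvelope ι) (L : Submodule R M)
    {y : M} (hy : y ∉ L) : ∃ φ : M →ₗ[R] I, (∀ x ∈ L, φ x = 0) ∧ φ y ≠ 0 := by
  obtain ⟨φ, hφ⟩ := hι.exists_apply_ne_zero (M := M ⧸ L) (y := Submodule.Quotient.mk y)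
    (by rwa [Ne, Submodule.Quotient.mk_eq_zero])
  exact ⟨φ ∘ₗ L.mkQ, fun x hx => by simp [(Submodule.Quotient.mk_eq_zero L).2 hx], hφ⟩

/-- Linear forms on a simple module are multiples of any nonzero one. -/
theorem IsInjectiveEnvelope.exists_smul_eq_of_isSimpleModule (hι : IsInjectiveEnvelope ι)
    [IsSimpleModule R M] (φ : M →ₗ[R] I) (x : M) (hx : φ x ≠ 0) (z : I)
    (hz : ∀ r : R, (∀ m : M, r • m = 0) → r • z = 0) : ∃ r : R, φ (r • x) = z := by
  have hm : (Module.annihilator R M).IsMaximal := IsSimpleModule.annihilator_isMaximal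
  obtain ⟨r, hr⟩ := hι.exists_smul_eq (Module.annihilator R M) (x := φ x) (y := z)
    (fun r hr => by rw [← map_smul, Module.mem_annihilator.1 hr, map_zero])
    (fun r hr => hz r (Module.mem_annihilator.1 hr)) hx
  exact ⟨r, by rw [map_smul, hr]⟩

theorem IsInjectiveEnvelope.exists_smul_eq_linearMap (hι : IsInjectiveEnvelope ι)
    [IsSimpleModule R M] (φ ψ : M →ₗ[R] I) (hφ : φ ≠ 0) : ∃ r : R, r • φ = ψ := by
  obtain ⟨x, hx⟩ : ∃ x, φ x ≠ 0 := by
    by_contra! h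
    exact hφ (LinearMap.ext h)
  have hx0 : x ≠ 0 := by rintro rfl; simp at hx
  obtain ⟨r, hr⟩ := hι.exists_smul_eq_of_isSimpleModule φ x hx (ψ x)
    (fun r hr => by rw [← map_smul, hr, map_zero])
  refine ⟨r, LinearMap.ext fun m => ?_⟩
  obtain ⟨s, rfl⟩ := (isSimpleModule_iff_toSpanSingleton_surjective.1 ‹_›).2 x hx0 m
  simp only [LinearMap.toSpanSingleton_apply, LinearMap.smul_apply, map_smul] at hr ⊢
  rw [← hr, smul_comm]

/-- Modules of finite length have finitely generated dual. -/
theorem IsInjectiveEnvelope.finite_dual [IsArtinianRing R] (hι : IsInjectiveEnvelope ι) (hM : IsFiniteLength R M) :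
    Module.Finite R (M →ₗ[R] I) := by
  revert hM
  suffices ∀ (M : Type u) [AddCommGroup M] [Module R M], IsFiniteLength R M →
      IsNoetherian R (M →ₗ[R] I) from fun hM => have := this M hM; inferInstance
  intro M _ _ hM
  induction hM with
  | of_subsingleton => infer_instance
  | @of_simple_quotient M _ _ N _ _ ih =>
    have h1 : IsNoetherian R ((M ⧸ N) →ₗ[R] I) := by
      have : Module.Finite R ((M ⧸ N) →ₗ[R] I) := by
        by_cases h : ∃ φ : (M ⧸ N) →ₗ[R] I, φ ≠ 0
        · obtain ⟨φ, hφ⟩ := h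
          refine ⟨⟨{φ}, ?_⟩⟩
          rw [eq_top_iff]
          intro ψ _
          obtain ⟨r, rfl⟩ := hι.exists_smul_eq_linearMap φ ψ hφ
          exact Submodule.smul_mem _ _ (Submodule.subset_span (by simp))
        · push Not at h
          have : Subsingleton ((M ⧸ N) →ₗ[R] I) := ⟨fun a b => by rw [h a, h b]⟩
          infer_instance
      infer_instance
    refine isNoetherian_of_range_eq_ker (LinearMap.lcomp R I N.mkQ) (LinearMap.lcomp R I N.subtype)
      (le_antisymm ?_ ?_)
    · rintro _ ⟨φ, rfl⟩
      ext x
      change φ (N.mkQ x) = 0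
      rw [N.mkQ_apply, (Submodule.Quotient.mk_eq_zero N).2 x.2, map_zero]
    · intro φ hφ
      refine ⟨N.liftQ φ fun x hx => LinearMap.congr_fun hφ ⟨x, hx⟩, ?_⟩
      ext x
      rfl

/-- Evaluation of a module of finite length into its bidual is surjective. -/
theorem IsInjectiveEnvelope.exists_eval_eq [IsArtinianRing R] (hι : IsInjectiveEnvelope ι) (hM : IsFiniteLength R M)
    (ξ : (M →ₗ[R] I) →ₗ[R] I) : ∃ x : M, ∀ φ, ξ φ = φ x := by
  induction hM with
  | of_subsingleton =>
    exact ⟨0, fun φ => by rw [show φ = 0 from Subsingleton.elim _ _, map_zero, LinearMap.zero_apply]⟩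
  | @of_simple_quotient M _ _ N _ _ ih =>
    have := IsSimpleModule.nontrivial R (M ⧸ N)
    have hS : ∀ ξ : ((M ⧸ N) →ₗ[R] I) →ₗ[R] I, ∃ x : M ⧸ N, ∀ φ, ξ φ = φ x := by
      intro ξ
      obtain ⟨y, hy⟩ := exists_ne (0 : M ⧸ N)
      obtain ⟨φ, hφ⟩ := hι.exists_apply_ne_zero hy
      obtain ⟨r, hr⟩ := hι.exists_smul_eq_of_isSimpleModule φ y hφ (ξ φ) (fun r hr => by
        rw [← map_smul, show r • φ = 0 from LinearMap.ext fun x => by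
          rw [LinearMap.smul_apply, ← map_smul, hr, map_zero, LinearMap.zero_apply], map_zero])
      refine ⟨r • y, fun ψ => ?_⟩
      obtain ⟨s, rfl⟩ := hι.exists_smul_eq_linearMap φ ψ (by rintro rfl; simp at hφ)
      rw [map_smul, ← hr, LinearMap.smul_apply]
    obtain ⟨x, hx⟩ := hS (ξ ∘ₗ LinearMap.lcomp R I N.mkQ)
    obtain ⟨x, rfl⟩ := N.mkQ_surjective x
    have hsurj : Function.Surjective (LinearMap.lcomp R I N.subtype) := fun ψ =>
      hι.exists_extension N.subtype N.injective_subtype ψ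
    let ev : M →ₗ[R] (M →ₗ[R] I) →ₗ[R] I := LinearMap.flip LinearMap.id
    -- On forms vanishing on `N`, which come from the simple quotient, `ξ` is evaluation at `x`.
    -- Hence `ξ - ev x` descends to a functional on the dual of `N`, to which induction applies.
    have hker : LinearMap.ker (LinearMap.lcomp R I N.subtype) ≤ LinearMap.ker (ξ - ev x) := by
      intro φ hφ
      have h0 := hx (N.liftQ φ fun x hx => LinearMap.congr_fun hφ ⟨x, hx⟩)
      have e : LinearMap.lcomp R I N.mkQ (N.liftQ φ fun x hx => LinearMap.congr_fun hφ ⟨x, hx⟩)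
        = φ := by ext; rfl
      rw [LinearMap.comp_apply, e] at h0
      rw [LinearMap.mem_ker, LinearMap.sub_apply, h0, sub_eq_zero]
      rfl
    let e := (LinearMap.lcomp R I N.subtype).quotKerEquivOfSurjective hsurj
    let ζ : (N →ₗ[R] I) →ₗ[R] I :=
      (LinearMap.ker (LinearMap.lcomp R I N.subtype)).liftQ (ξ - ev x) hker ∘ₗ e.symm.toLinearMap
    have hζ : ∀ φ : M →ₗ[R] I, ζ (φ ∘ₗ N.subtype) = ξ φ - φ x := by
      intro φ
      have : φ ∘ₗ N.subtype = e (Submodule.Quotient.mk φ) := rfl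
      simp only [ζ, LinearMap.comp_apply, LinearEquiv.coe_coe]
      rw [this, LinearEquiv.symm_apply_apply, Submodule.liftQ_apply]
      rfl
    obtain ⟨n, hn⟩ := ih ζ
    refine ⟨x + n, fun φ => ?_⟩
    have := hn (φ ∘ₗ N.subtype)
    rw [hζ] at this
    rw [map_add, ← sub_eq_iff_eq_add', this]
    rfl

end Matlis

/-! ### The injective module `DA` and its endomorphism ring -/

section DualModule

variable {R A I : Type u} [CommRing R] [Ring A] [Algebra R A] [AddCommGroup I] [Module R I]

/-- A linear form on `A` as an element of `DA`. -/
def Dual.mk (f : A →ₗ[R] I) : Dual R A I := f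

@[simp]
theorem Dual.mk_apply (f : A →ₗ[R] I) (x : A) : Dual.mk f x = f x := rfl

theorem Dual.map_smul_of_tower (f : Dual R A I) (r : R) (x : A) : f (r • x) = r • f x :=
  LinearMap.map_smul (show A →ₗ[R] I from f) r x

theorem Dual.sum_apply {κ : Type*} (s : Finset κ) (f : κ → Dual R A I) (x : A) :
    (∑ k ∈ s, f k) x = ∑ k ∈ s, f k x := by
  classical
  induction s using Finset.induction_on with
  | empty => simp
  | insert k s hk ih => simp [Finset.sum_insert hk, ih]

noncomputable instance : Module R (Dual R A I) := inferInstanceAs (Module R (A →ₗ[R] I))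

@[simp]
theorem Dual.base_smul_apply (r : R) (f : Dual R A I) (x : A) : (r • f) x = r • f x := rfl

instance : IsScalarTower R A (Dual R A I) where
  smul_assoc r a f := by
    ext x
    simp [Dual.map_smul_of_tower]

variable {M : Type u} [AddCommGroup M] [Module R M] [Module A M] [IsScalarTower R A M]

/-- The `A`-linear map `M → DA` corresponding to an `R`-linear form on `M`. -/
noncomputable def Dual.ofForm (ψ : M →ₗ[R] I) : M →ₗ[A] Dual R A I where
  toFun m := Dual.mk (ψ ∘ₗ (LinearMap.toSpanSingleton A M m).restrictScalars R)
  map_add' m m' := by ext; simp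
  map_smul' a m := by ext; simp [mul_smul]

@[simp]
theorem Dual.ofForm_apply (ψ : M →ₗ[R] I) (m : M) (a : A) :
    Dual.ofForm ψ m a = ψ (a • m) := rfl

variable (R) in
/-- Evaluation at `1`. -/
noncomputable def Dual.evalOne : Dual R A I →ₗ[R] I where
  toFun f := f 1
  map_add' _ _ := rfl
  map_smul' _ _ := rfl

@[simp]
theorem Dual.evalOne_apply (f : Dual R A I) : Dual.evalOne R f = f 1 := rfl

variable {ι : (R ⧸ Ring.jacobson R) →ₗ[R] I}

/-- Evaluation at `1` identifies `Hom_A(M, DA)` with `Hom_R(M, I)`, so injectivity is inherited from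
`I`. -/
theorem IsInjectiveEnvelope.injective_dual (hι : IsInjectiveEnvelope ι) :
    Module.Injective A (Dual R A I) where
  out X Y _ _ _ _ i hi g := by
    let _ := Module.compHom X (algebraMap R A)
    let _ := Module.compHom Y (algebraMap R A)
    have : IsScalarTower R A X := ⟨fun r a x => by rw [Algebra.smul_def, mul_smul]; rfl⟩
    have : IsScalarTower R A Y := ⟨fun r a x => by rw [Algebra.smul_def, mul_smul]; rfl⟩
    obtain ⟨ψ, hψ⟩ := hι.exists_extension (i.restrictScalars R) hi
      (Dual.evalOne R ∘ₗ g.restrictScalars R)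
    refine ⟨Dual.ofForm ψ, fun x => ?_⟩
    ext a
    have := LinearMap.congr_fun hψ (a • x)
    simpa using this

@[simp]
theorem dualHom_smul_apply {N : Type u} [AddCommGroup N] [Module A N] (a : A)
    (g : Dual R A I →ₗ[A] N) (f : Dual R A I) : (a • g) f = g (MulOpposite.op a • f) := rfl

variable (R A I) in
/-- The right multiplications on `DA`. -/
noncomputable def rightMul : A →ₗ[A] (Dual R A I →ₗ[A] Dual R A I) where
  toFun a :=
    { toFun := fun f => MulOpposite.op a • f
      map_add' := fun _ _ => smul_add _ _ _
      map_smul' := fun b f => (smul_comm b (MulOpposite.op a) f).symm }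
  map_add' a b := by ext f; simp [add_mul, Dual.map_add]
  map_smul' a b := by ext f; simp [mul_assoc]

@[simp]
theorem rightMul_apply (a : A) (f : Dual R A I) : rightMul R A I a f = MulOpposite.op a • f := rfl

variable [IsArtinianRing R]

/-- The components come from finitely many generators of `Hom_R(M, I)`: an element killed by all of
them is killed by every form, and `I` is a cogenerator. -/
theorem IsInjectiveEnvelope.exists_dual_embedding (hι : IsInjectiveEnvelope ι)
    [Module.Finite R M] : ∃ (n : ℕ) (i : Fin n → M →ₗ[A] Dual R A I),
      ∀ m, (∀ k, i k m = 0) → m = 0 := by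
  have hM : IsFiniteLength R M := isFiniteLength_iff_isNoetherian_isArtinian.2
    ⟨inferInstance, inferInstance⟩
  have := hι.finite_dual hM
  obtain ⟨n, φ, hφ⟩ := Module.Finite.exists_fin (R := R) (M := M →ₗ[R] I)
  refine ⟨n, fun k => Dual.ofForm (φ k), fun m hm => ?_⟩
  by_contra hm0
  obtain ⟨ψ, hψ⟩ := hι.exists_apply_ne_zero hm0
  apply hψ
  have hψ' : ψ ∈ Submodule.span R (Set.range φ) := hφ ▸ Submodule.mem_top
  have : Submodule.span R (Set.range φ) ≤ LinearMap.ker (LinearMap.applyₗ (R := R) (M₂ := I) m) := by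
    rw [Submodule.span_le]
    rintro _ ⟨k, rfl⟩
    have := congrArg (fun f : Dual R A I => f 1) (hm k)
    simpa using this
  exact this hψ'

variable [Module.Finite R A]

theorem IsInjectiveEnvelope.finite_dual_ring (hι : IsInjectiveEnvelope ι) :
    Module.Finite R (Dual R A I) :=
  hι.finite_dual (M := A) (isFiniteLength_iff_isNoetherian_isArtinian.2
    ⟨inferInstance, inferInstance⟩)

variable (R A I) in
/-- Families of maps exhibiting `E` as a direct summand of a finite power of `DA`. -/
structure DualSummand (E : Type u) [AddCommGroup E] [Module A E] where
  /-- the number of copies -/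
  n : ℕ
  /-- the components of the inclusion -/
  i : Fin n → E →ₗ[A] Dual R A I
  /-- the components of the projection -/
  p : Fin n → Dual R A I →ₗ[A] E
  sum_eq : ∀ e, ∑ k, p k (i k e) = e

/-- An embedding of `N` into a power of `DA` extends to `E`. The extension stays injective because
`N` is essential in `E`, and it splits because `E` is injective. -/
theorem IsInjectiveEnvelope.nonempty_dualSummand (hι : IsInjectiveEnvelope ι)
    {N E : Type u} [AddCommGroup N] [Module A N] [AddCommGroup E] [Module A E]
    [Module.Finite A N] (j : N →ₗ[A] E) (hj : IsInjectiveEnvelope j) :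
    Nonempty (DualSummand R A I E) := by
  let _ := Module.compHom N (algebraMap R A)
  have : IsScalarTower R A N := ⟨fun r a x => by rw [Algebra.smul_def, mul_smul]; rfl⟩
  have : Module.Finite R N := Module.Finite.trans A N
  obtain ⟨n, i, hi⟩ := hι.exists_dual_embedding (A := A) (M := N)
  have hinj := hι.injective_dual (A := A)
  choose i' hi' using fun k => hinj.out j hj.2.1 (i k)
  have hker : Function.Injective (LinearMap.pi i') := by
    rw [← LinearMap.ker_eq_bot]
    apply hj.2.2
    rw [eq_bot_iff]
    rintro _ ⟨he, x, rfl⟩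
    rw [Submodule.mem_bot, hi x, map_zero]
    intro k
    rw [← hi']
    exact congrFun he k
  obtain ⟨p, hp⟩ := hj.1.out (LinearMap.pi i') hker LinearMap.id
  classical
  refine ⟨⟨n, i', fun k => p ∘ₗ LinearMap.single A (fun _ => Dual R A I) k, fun e => ?_⟩⟩
  simp only [LinearMap.comp_apply]
  rw [← map_sum]
  refine Eq.trans (congrArg p ?_) (hp e)
  ext k x
  simp [Pi.single_apply]

theorem DualSummand.finite (hι : IsInjectiveEnvelope ι) {E : Type u} [AddCommGroup E] [Module A E]
    (D : DualSummand R A I E) : Module.Finite A E := by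
  have := hι.finite_dual_ring (A := A)
  have : Module.Finite A (Dual R A I) := Module.Finite.of_restrictScalars_finite R A _
  refine Module.Finite.of_surjective (LinearMap.lsum A (fun _ => Dual R A I) ℕ D.p) fun e =>
    ⟨fun k => D.i k e, ?_⟩
  simpa using D.sum_eq e

/-- An endomorphism `θ` is determined by the functional `f ↦ θ f 1` on `DA`. This is an element of
the `R`-bidual of `A`, hence evaluation at some `a`. -/
theorem rightMul_bijective (hι : IsInjectiveEnvelope ι) :
    Function.Bijective (rightMul R A I) := by
  constructor
  · rw [injective_iff_map_eq_zero]
    intro a ha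
    by_contra h
    obtain ⟨φ, hφ⟩ := hι.exists_apply_ne_zero h
    have := congrArg (fun f : Dual R A I => f 1) (LinearMap.congr_fun ha (Dual.mk φ))
    simp at this
    exact hφ this
  · intro θ
    obtain ⟨a, ha⟩ := hι.exists_eval_eq (M := A) (isFiniteLength_iff_isNoetherian_isArtinian.2
      ⟨inferInstance, inferInstance⟩)
      (Dual.evalOne R ∘ₗ θ.restrictScalars R : Dual R A I →ₗ[R] I)
    refine ⟨a, ?_⟩
    ext φ b
    have h1 := ha (b • φ : Dual R A I)
    have h2 : θ (b • φ) 1 = φ (a * b) := h1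
    rw [map_smul] at h2
    simpa using h2.symm

/-- The scalar by which an endomorphism of `DA` acts on the right. -/
noncomputable def scalar (hι : IsInjectiveEnvelope ι) : (Dual R A I →ₗ[A] Dual R A I) ≃ₗ[A] A :=
  (LinearEquiv.ofBijective _ (rightMul_bijective hι)).symm

theorem apply_eq_scalar_smul (hι : IsInjectiveEnvelope ι) (θ : Dual R A I →ₗ[A] Dual R A I)
    (f : Dual R A I) : θ f = MulOpposite.op (scalar hι θ) • f :=
  (LinearMap.congr_fun ((LinearEquiv.ofBijective _ (rightMul_bijective hι)).apply_symm_apply θ)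
    f).symm

end DualModule

/-! ### The trace pairing and Nakayama duality -/

section Pairing

variable {R A I : Type u} [CommRing R] [Ring A] [Algebra R A] [AddCommGroup I] [Module R I]
  {ι : (R ⧸ Ring.jacobson R) →ₗ[R] I} {E E₀ E₁ : Type u} [AddCommGroup E] [Module A E] [AddCommGroup E₀] [Module A E₀]
  [AddCommGroup E₁] [Module A E₁]

/-- The map `Hom_A(DA, E₀) → Hom_A(DA, E₁)` induced by `δ`. -/
noncomputable def dualHomMap (δ : E₀ →ₗ[A] E₁) :
    (Dual R A I →ₗ[A] E₀) →ₗ[A] (Dual R A I →ₗ[A] E₁) where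
  toFun g := δ ∘ₗ g
  map_add' g h := LinearMap.comp_add g h δ
  map_smul' _ _ := rfl

@[simp]
theorem dualHomMap_apply (δ : E₀ →ₗ[A] E₁) (g : Dual R A I →ₗ[A] E₀) :
    dualHomMap δ g = δ ∘ₗ g := rfl

/-- The trace form of an `A`-linear map `Hom_A(DA, E) → E`. -/
noncomputable def DualSummand.trace (D : DualSummand R A I E)
    (θ : (Dual R A I →ₗ[A] E) →ₗ[A] E) : I :=
  ∑ j, D.i j (θ (D.p j)) 1

variable [IsArtinianRing R] [Module.Finite R A]

/-- The coordinate forms of `Hom_A(DA, E)`. -/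
noncomputable def DualSummand.coord (hι : IsInjectiveEnvelope ι) (D : DualSummand R A I E)
    (k : Fin D.n) : (Dual R A I →ₗ[A] E) →ₗ[A] A :=
  (scalar hι).toLinearMap ∘ₗ dualHomMap (D.i k)

theorem DualSummand.i_apply (hι : IsInjectiveEnvelope ι) (D : DualSummand R A I E)
    (k : Fin D.n) (q : Dual R A I →ₗ[A] E) (f : Dual R A I) :
    D.i k (q f) = MulOpposite.op (D.coord hι k q) • f :=
  apply_eq_scalar_smul hι (D.i k ∘ₗ q) f

/-- The `D.p k` and `D.coord hι k` form a dual basis of `Hom_A(DA, E)`. This makes it finitely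
generated projective and drives all trace computations. -/
theorem DualSummand.sum_coord_smul (hι : IsInjectiveEnvelope ι) (D : DualSummand R A I E)
    (q : Dual R A I →ₗ[A] E) : ∑ k, D.coord hι k q • D.p k = q := by
  ext f
  simp only [LinearMap.coe_sum, Finset.sum_apply, dualHom_smul_apply, ← D.i_apply hι]
  exact D.sum_eq (q f)

theorem DualSummand.finite_dualHom (hι : IsInjectiveEnvelope ι) (D : DualSummand R A I E) :
    Module.Finite A (Dual R A I →ₗ[A] E) := by
  refine Module.Finite.of_surjective (Fintype.linearCombination A D.p) fun q =>
    ⟨fun k => D.coord hι k q, ?_⟩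
  simpa [Fintype.linearCombination_apply] using D.sum_coord_smul hι q

theorem DualSummand.projective_dualHom (hι : IsInjectiveEnvelope ι) (D : DualSummand R A I E) :
    Module.Projective A (Dual R A I →ₗ[A] E) := by
  refine Module.Projective.of_split (LinearMap.pi fun k => D.coord hι k)
    (Fintype.linearCombination A D.p) ?_
  ext1 q
  simpa [Fintype.linearCombination_apply] using D.sum_coord_smul hι q

variable {M : Type u} [AddCommGroup M] [Module R M] [Module A M] [IsScalarTower R A M]

/-- Cyclicity of the trace: expanded in the two dual bases, both sides become the same double sum.
It makes precomposition with `dualHomMap δ` adjoint to composition with `δ`. -/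
theorem DualSummand.trace_comp (hι : IsInjectiveEnvelope ι) (D₀ : DualSummand R A I E₀)
    (D₁ : DualSummand R A I E₁) (δ : E₀ →ₗ[A] E₁) (θ : (Dual R A I →ₗ[A] E₁) →ₗ[A] E₀) :
    D₀.trace (θ ∘ₗ dualHomMap δ) = D₁.trace (δ ∘ₗ θ) := by
  have h0 : ∀ j, D₀.i j (θ (δ ∘ₗ D₀.p j)) 1 =
      ∑ k, D₀.i j (θ (D₁.p k)) (D₁.coord hι k (δ ∘ₗ D₀.p j)) := by
    intro j
    conv_lhs => rw [← D₁.sum_coord_smul hι (δ ∘ₗ D₀.p j)]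
    simp only [map_sum, map_smul, Dual.sum_apply, Dual.smul_apply, one_mul]
  have h1 : ∀ k, D₁.i k (δ (θ (D₁.p k))) 1 =
      ∑ j, D₀.i j (θ (D₁.p k)) (D₁.coord hι k (δ ∘ₗ D₀.p j)) := by
    intro k
    conv_lhs => rw [← D₀.sum_eq (θ (D₁.p k))]
    simp only [map_sum, Dual.sum_apply]
    refine Finset.sum_congr rfl fun j _ => ?_
    have := D₁.i_apply hι k (δ ∘ₗ D₀.p j) (D₀.i j (θ (D₁.p k)))
    rw [LinearMap.comp_apply] at this
    rw [this]
    simp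
  simp only [DualSummand.trace, LinearMap.comp_apply, dualHomMap_apply, h0, h1]
  exact Finset.sum_comm

/-- Nondegeneracy of the trace pairing in `Hom_A(M, E)`. -/
theorem DualSummand.eq_zero_of_trace_eq_zero (hι : IsInjectiveEnvelope ι) (D : DualSummand R A I E)
    {M : Type u} [AddCommGroup M] [Module A M] (h : M →ₗ[A] E)
    (hh : ∀ g : (Dual R A I →ₗ[A] E) →ₗ[A] M, D.trace (h ∘ₗ g) = 0) : h = 0 := by
  have key : ∀ k m, D.i k (h m) 1 = 0 := by
    intro k m
    -- Testing against the rank one map `q ↦ coord k q • m` isolates the value at `1` of the `k`-th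
    -- component of `h m`.
    have := hh (LinearMap.toSpanSingleton A M m ∘ₗ D.coord hι k)
    rw [← this]
    conv_lhs => rw [← D.sum_eq (h m)]
    simp only [DualSummand.trace, LinearMap.comp_apply, LinearMap.toSpanSingleton_apply, map_smul,
      Dual.smul_apply, one_mul, map_sum, Dual.sum_apply]
    refine Finset.sum_congr rfl fun j _ => ?_
    rw [D.i_apply hι]
    simp
  ext m
  rw [← D.sum_eq (h m), LinearMap.zero_apply]
  refine Finset.sum_eq_zero fun k _ => ?_
  rw [show D.i k (h m) = 0 from ?_, map_zero]
  ext b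
  have := key k (b • m)
  simpa using this

/-- Each linear form on `Hom_A(Hom_A(DA, E), M)` is given by the trace pairing. -/
theorem DualSummand.exists_trace_eq (hι : IsInjectiveEnvelope ι) (D : DualSummand R A I E)
    (ψ : ((Dual R A I →ₗ[A] E) →ₗ[A] M) →ₗ[R] I) :
    ∃ h : M →ₗ[A] E, ∀ g, ψ g = D.trace (h ∘ₗ g) := by
  -- By the dual basis, every map is a sum of rank one maps `L k m`. So `ψ` is determined by the
  -- forms `ψ ∘ L k` on `M`; these give maps `M → DA`, which the projections `D.p k` assemble into
  -- `h`.
  let L : Fin D.n → M →ₗ[R] ((Dual R A I →ₗ[A] E) →ₗ[A] M) := fun k =>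
    { toFun := fun m => LinearMap.toSpanSingleton A M m ∘ₗ D.coord hι k
      map_add' := fun m m' => by ext; simp
      map_smul' := fun r m => LinearMap.ext fun q => smul_comm (D.coord hι k q) r m }
  have hL : ∀ k m q, L k m q = D.coord hι k q • m := fun _ _ _ => rfl
  refine ⟨∑ k, D.p k ∘ₗ Dual.ofForm (ψ ∘ₗ L k), fun g => ?_⟩
  have h1 : ∀ j k, D.i j (D.p k (Dual.ofForm (ψ ∘ₗ L k) (g (D.p j)))) 1 =
      ψ (L k (D.coord hι j (D.p k) • g (D.p j))) := by
    intro j k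
    rw [D.i_apply hι]
    simp
  simp only [DualSummand.trace, LinearMap.comp_apply, LinearMap.coe_sum, Finset.sum_apply, map_sum,
    Dual.sum_apply, h1]
  have h2 : ψ g = ψ (∑ j, ∑ k, L k (D.coord hι j (D.p k) • g (D.p j))) := by
    congr 1
    ext q
    simp only [LinearMap.coe_sum, Finset.sum_apply, hL, smul_smul, ← map_smul, ← map_sum]
    congr 1
    rw [Finset.sum_comm]
    conv_lhs => rw [← D.sum_coord_smul hι q]
    refine Finset.sum_congr rfl fun k _ => ?_
    simp only [mul_smul, ← Finset.smul_sum]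
    rw [D.sum_coord_smul hι]
  rw [h2]
  simp only [map_sum]

/-- A map is surjective exactly when its transpose is injective. A form vanishing on the range of
precomposition with `dualHomMap δ` is the trace against some `h` with `δ ∘ h = 0`, and forms
separate points from submodules. -/
theorem forall_exists_comp_dualHomMap_iff (hι : IsInjectiveEnvelope ι) (D₀ : DualSummand R A I E₀)
    (D₁ : DualSummand R A I E₁) (δ : E₀ →ₗ[A] E₁) :
    (∀ f : (Dual R A I →ₗ[A] E₀) →ₗ[A] M, ∃ g : (Dual R A I →ₗ[A] E₁) →ₗ[A] M,
      g ∘ₗ dualHomMap δ = f) ↔ ∀ h : M →ₗ[A] E₀, δ ∘ₗ h = 0 → h = 0 := by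
  constructor
  · intro H h hh
    refine D₀.eq_zero_of_trace_eq_zero hι h fun f => ?_
    obtain ⟨g, rfl⟩ := H f
    rw [← LinearMap.comp_assoc, D₀.trace_comp hι D₁, ← LinearMap.comp_assoc, hh]
    simp [DualSummand.trace]
  · intro H f
    let L : ((Dual R A I →ₗ[A] E₁) →ₗ[A] M) →ₗ[R] ((Dual R A I →ₗ[A] E₀) →ₗ[A] M) :=
      LinearMap.lcomp R M (dualHomMap δ)
    by_contra hf
    obtain ⟨ψ, hψ, hψf⟩ := hι.exists_separating (LinearMap.range L) (y := f) hf
    obtain ⟨h, hh⟩ := D₀.exists_trace_eq hι ψ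
    apply hψf
    rw [hh, H h]
    · simp [DualSummand.trace]
    · refine D₁.eq_zero_of_trace_eq_zero hι _ fun g => ?_
      rw [LinearMap.comp_assoc, ← D₀.trace_comp hι D₁, LinearMap.comp_assoc, ← hh]
      exact hψ _ ⟨g, rfl⟩

theorem eq_zero_of_comp_dualHomMap_eq_zero (hι : IsInjectiveEnvelope ι) (D₀ : DualSummand R A I E₀)
    (D₁ : DualSummand R A I E₁) (δ : E₀ →ₗ[A] E₁)
    (H : ∀ h : M →ₗ[A] E₁, ∃ k : M →ₗ[A] E₀, δ ∘ₗ k = h)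
    (g : (Dual R A I →ₗ[A] E₁) →ₗ[A] M) (hg : g ∘ₗ dualHomMap δ = 0) : g = 0 := by
  by_contra hg0
  obtain ⟨ψ, hψ⟩ := hι.exists_apply_ne_zero (R := R) hg0
  obtain ⟨h, hh⟩ := D₁.exists_trace_eq hι ψ
  obtain ⟨k, rfl⟩ := H h
  apply hψ
  rw [hh, LinearMap.comp_assoc, ← D₀.trace_comp hι D₁, LinearMap.comp_assoc, hg]
  simp [DualSummand.trace]

end Pairing

/-! ### The functor `DA ⊗ -` and the pairing of `Hom_A(X, A)` with `DA ⊗ X` -/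

section DualTensor

variable {R A I : Type u} [CommRing R] [Ring A] [Algebra R A] [AddCommGroup I] [Module R I]
  {X : ModuleCat.{u} A} {N : Type u} [AddCommGroup N] [Module A N]

/-- The map `DA ⊗_A X → N` induced by a balanced map. -/
noncomputable def dualTensorLift (B : Dual R A I →ₗ[A] X →ₗ[ℤ] N)
    (hB : ∀ f (a : A) x, B (MulOpposite.op a • f) x = B f (a • x)) : dualTensor R A I X →ₗ[A] N :=
  Submodule.liftQ _ (TensorProduct.AlgebraTensorModule.lift B) <| by
    rw [Submodule.span_le]
    rintro _ ⟨f, a, m, rfl⟩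
    simp [hB]

/-- The class of `f ⊗ x` in `DA ⊗_A X`. -/
noncomputable def dualTmul (f : Dual R A I) (x : X) : dualTensor R A I X :=
  Submodule.Quotient.mk (f ⊗ₜ[ℤ] x)

@[simp]
theorem dualTensorLift_tmul (B : Dual R A I →ₗ[A] X →ₗ[ℤ] N)
    (hB : ∀ f (a : A) x, B (MulOpposite.op a • f) x = B f (a • x)) (f : Dual R A I) (x : X) :
    dualTensorLift B hB (dualTmul f x) = B f x :=
  (Submodule.liftQ_apply _ _ _).trans (by simp)

theorem dualTensor_induction {p : dualTensor R A I X → Prop} (h0 : p 0)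
    (ht : ∀ f x, p (dualTmul f x)) (ha : ∀ s t, p s → p t → p (s + t)) (t) : p t := by
  obtain ⟨t, rfl⟩ := Submodule.Quotient.mk_surjective _ t
  induction t using TensorProduct.induction_on with
  | zero => exact h0
  | tmul f x => exact ht f x
  | add s t hs ht => exact ha _ _ hs ht

/-- Maps from `DA ⊗_A X` vanish if and only if maps to `Hom_A(DA, -)` do. -/
theorem eq_zero_of_forall_dualTensor_eq_zero
    (H : ∀ w : dualTensor R A I X →ₗ[A] N, w = 0) (v : X →ₗ[A] Dual R A I →ₗ[A] N) : v = 0 := by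
  let B : Dual R A I →ₗ[A] X →ₗ[ℤ] N :=
    { toFun := fun f =>
        { toFun := fun x => v x f
          map_add' := by simp
          map_smul' := by simp }
      map_add' := fun f g => by ext; simp
      map_smul' := fun a f => by ext; simp }
  have hB : ∀ f (a : A) x, B (MulOpposite.op a • f) x = B f (a • x) := fun f a x => by
    simp [B]
  ext x f
  have := dualTensorLift_tmul B hB f x
  rw [H (dualTensorLift B hB)] at this
  exact this.symm

/-- The map `DA ⊗_A X → DA` induced by a form `X → A`. -/
noncomputable def dualTensorForm (R I : Type u) [CommRing R] [Algebra R A] [AddCommGroup I]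
    [Module R I] (c : X →ₗ[A] A) :
    dualTensor R A I X →ₗ[A] Dual R A I :=
  dualTensorLift
    { toFun := fun f =>
        (AddMonoidHom.mk' (fun x => MulOpposite.op (c x) • f)
          (fun x y => by simp [add_smul])).toIntLinearMap
      map_add' := fun f g => by ext; simp
      map_smul' := fun a f => by ext; simp [mul_assoc] }
    (fun f a x => by ext; simp [mul_assoc])

@[simp]
theorem dualTensorForm_tmul (c : X →ₗ[A] A) (f : Dual R A I) (x : X) :
    dualTensorForm R I c (dualTmul f x) = MulOpposite.op (c x) • f := by
  simp [dualTensorForm]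

theorem dualTensorForm_zero : dualTensorForm R I (0 : X →ₗ[A] A) = 0 := by
  ext t : 1
  induction t using dualTensor_induction with
  | h0 => simp
  | ht f x => simp
  | ha s t hs ht => rw [map_add, map_add, hs, ht]

theorem dualTensorForm_sum {κ : Type*} (s : Finset κ) (c : κ → X →ₗ[A] A)
    (t : dualTensor R A I X) :
    dualTensorForm R I (∑ k ∈ s, c k) t = ∑ k ∈ s, dualTensorForm R I (c k) t := by
  induction t using dualTensor_induction with
  | h0 => simp
  | ht f x => simp [Finset.sum_smul]
  | ha s t hs ht => simp only [map_add, hs, ht, Finset.sum_add_distrib]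

/-- Right multiplication of forms by scalars. -/
theorem dualTensorForm_smul_apply (c : X →ₗ[A] A) (a : A) (t : dualTensor R A I X) :
    dualTensorForm R I c (a • t) 1 =
      dualTensorForm R I (LinearMap.toSpanSingleton A A a ∘ₗ c) t 1 := by
  rw [map_smul]
  induction t using dualTensor_induction with
  | h0 => simp
  | ht f x => simp
  | ha s t hs ht =>
    simp only [map_add, smul_add, Dual.add_apply] at hs ht ⊢
    rw [hs, ht]

end DualTensor

theorem exists_dual_basis (A P : Type u) [Ring A] [AddCommGroup P] [Module A P]
    [Module.Finite A P] [Module.Projective A P] :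
    ∃ (n : ℕ) (e : Fin n → P) (c : Fin n → P →ₗ[A] A), ∀ x, ∑ k, c k x • e k = x := by
  obtain ⟨n, f, g, -, -, h⟩ := Module.Finite.exists_comp_eq_id_of_projective A P
  refine ⟨n, fun k => f (Pi.single k 1), fun k => LinearMap.proj k ∘ₗ g, fun x => ?_⟩
  have := LinearMap.congr_fun h x
  rw [LinearMap.comp_apply, LinearMap.pi_apply_eq_sum_univ f (g x)] at this
  refine Eq.trans (Finset.sum_congr rfl fun k _ => ?_) this
  dsimp only
  rw [show (Pi.single k 1 : Fin n → A) = fun j => if k = j then 1 else 0 from ?_]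
  · rfl
  · ext j
    simp [Pi.single_apply, eq_comm]

section Forms

variable {R A I : Type u} [CommRing R] [Ring A] [Algebra R A] [AddCommGroup I] [Module R I]
  {X : ModuleCat.{u} A} [IsArtinianRing R] {ι : (R ⧸ Ring.jacobson R) →ₗ[R] I}

/-- The pairing `⟨c, f ⊗ x⟩ = f (c x)` detects elements of `Hom_A(X, A)`. To see that `⟨c ∘ u, t⟩ =
0`, the map `p ↦ c p • t` is extended along `d` to `g`; dual bases of `P₁` and `P₀` then shift `d`
onto `u`, where `d ∘ u = 0`. -/
theorem eq_zero_of_forall_exists_comp_eq (hι : IsInjectiveEnvelope ι)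
    {P₁ P₀ : Type u} [AddCommGroup P₁] [Module A P₁] [AddCommGroup P₀] [Module A P₀]
    [Module.Finite A P₁] [Module.Projective A P₁] [Module.Finite A P₀] [Module.Projective A P₀]
    (d : P₁ →ₗ[A] P₀)
    (H : ∀ g : P₁ →ₗ[A] dualTensor R A I X, ∃ g' : P₀ →ₗ[A] dualTensor R A I X, g' ∘ₗ d = g)
    (u : X →ₗ[A] P₁) (hu : d ∘ₗ u = 0) : u = 0 := by
  obtain ⟨n, e₁, c₁, h₁⟩ := exists_dual_basis A P₁
  obtain ⟨m, e₀, c₀, h₀⟩ := exists_dual_basis A P₀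
  have key : ∀ (c : P₁ →ₗ[A] A) (t : dualTensor R A I X),
      dualTensorForm R I (c ∘ₗ u) t 1 = 0 := by
    intro c t
    obtain ⟨g, hg⟩ := H (LinearMap.toSpanSingleton A _ t ∘ₗ c)
    have e1 : c ∘ₗ u = ∑ j, LinearMap.toSpanSingleton A A (c (e₁ j)) ∘ₗ (c₁ j ∘ₗ u) := by
      ext x
      simp only [LinearMap.comp_apply, LinearMap.coe_sum, Finset.sum_apply,
        LinearMap.toSpanSingleton_apply, ← map_smul, ← map_sum, h₁]
    have e2 : ∀ j, c (e₁ j) • t = ∑ k, c₀ k (d (e₁ j)) • g (e₀ k) := by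
      intro j
      simp only [← map_smul, ← map_sum, h₀]
      exact (LinearMap.congr_fun hg (e₁ j)).symm
    rw [e1, dualTensorForm_sum, Dual.sum_apply]
    simp only [← dualTensorForm_smul_apply, e2, map_sum, Dual.sum_apply]
    simp only [dualTensorForm_smul_apply]
    rw [Finset.sum_comm]
    refine Finset.sum_eq_zero fun k _ => ?_
    rw [← Dual.sum_apply, ← dualTensorForm_sum]
    -- After the exchange of sums, the form paired with `g (e₀ k)` is `c₀ k ∘ d ∘ u`.
    have e3 : ∑ j, LinearMap.toSpanSingleton A A (c₀ k (d (e₁ j))) ∘ₗ (c₁ j ∘ₗ u) = 0 := by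
      ext x
      simp only [LinearMap.comp_apply, LinearMap.coe_sum, Finset.sum_apply,
        LinearMap.toSpanSingleton_apply, ← map_smul, ← map_sum, h₁]
      rw [show d (u x) = 0 from LinearMap.congr_fun hu x, map_zero, LinearMap.zero_apply]
    rw [e3, dualTensorForm_zero]
    rfl
  ext x
  rw [← h₁ (u x), LinearMap.zero_apply]
  refine Finset.sum_eq_zero fun k _ => ?_
  rw [show c₁ k (u x) = 0 from ?_, zero_smul]
  by_contra hne
  obtain ⟨φ, hφ⟩ := hι.exists_apply_ne_zero hne
  have := key (c₁ k) (dualTmul (Dual.mk φ) x)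
  simp at this
  exact hφ this

end Forms

/-! ### Extension and lifting from the vanishing of Ext -/

section Lifting

variable {A : Type u} [Ring A]

theorem exists_comp_eq_of_surjective {P K N : Type*} [AddCommGroup P] [Module A P] [AddCommGroup K]
    [Module A K] [AddCommGroup N] [Module A N] (π : P →ₗ[A] K) (hπ : Function.Surjective π)
    (f : P →ₗ[A] N) (h : ∀ x, π x = 0 → f x = 0) : ∃ g : K →ₗ[A] N, g ∘ₗ π = f := by
  refine ⟨(LinearMap.ker π).liftQ f h ∘ₗ (π.quotKerEquivOfSurjective hπ).symm.toLinearMap, ?_⟩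
  ext x
  have : (π.quotKerEquivOfSurjective hπ).symm (π x) = Submodule.Quotient.mk x := by
    rw [LinearEquiv.symm_apply_eq]
    rfl
  simp only [LinearMap.comp_apply, LinearEquiv.coe_coe, this]
  rfl

/-- Maps from the kernel of `P → X` to `N` extend to `P` if `Ext¹(X, N) = 0`. -/
theorem exists_extension_of_ext_eq_zero (X N P : ModuleCat.{u} A)
    (h : Subsingleton (Abelian.Ext.{u} X N 1)) (ε : P →ₗ[A] X) (hε : Function.Surjective ε)
    (f : LinearMap.ker ε →ₗ[A] N) : ∃ g : P →ₗ[A] N, g ∘ₗ (LinearMap.ker ε).subtype = f := by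
  obtain ⟨x, hx⟩ := Abelian.Ext.contravariant_sequence_exact₁
    (LinearMap.shortExact_shortComplexKer hε) N (Abelian.Ext.mk₀ (ModuleCat.ofHom f)) (add_zero 1)
    (Subsingleton.elim (α := Abelian.Ext.{u} X N 1) _ _)
  obtain ⟨g, rfl⟩ := (Abelian.Ext.mk₀_bijective _ _).2 x
  rw [Abelian.Ext.mk₀_comp_mk₀] at hx
  exact ⟨g.hom, congrArg ModuleCat.Hom.hom ((Abelian.Ext.mk₀_bijective _ _).1 hx)⟩

/-- Maps from `M` to `C` lift along an epimorphism with kernel `Y` if `Ext¹(M, Y) = 0`. -/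
theorem exists_lift_of_ext_eq_zero (M Y E C : ModuleCat.{u} A)
    (h : Subsingleton (Abelian.Ext.{u} M Y 1)) (η : Y →ₗ[A] E) (δ : E →ₗ[A] C)
    (hη : Function.Injective η) (hδ : Function.Surjective δ) (hex : Function.Exact η δ)
    (f : M →ₗ[A] C) : ∃ g : M →ₗ[A] E, δ ∘ₗ g = f := by
  have hS : (ModuleCat.shortComplexOfCompEqZero η δ hex.linearMap_comp_eq_zero).ShortExact :=
    ModuleCat.shortComplex_shortExact _ hex hη hδ
  obtain ⟨x, hx⟩ := Abelian.Ext.covariant_sequence_exact₃ M hS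
    (Abelian.Ext.mk₀ (ModuleCat.ofHom f)) (zero_add 1)
    (Subsingleton.elim (α := Abelian.Ext.{u} M Y 1) _ _)
  obtain ⟨g, rfl⟩ := (Abelian.Ext.mk₀_bijective _ _).2 x
  rw [Abelian.Ext.mk₀_comp_mk₀] at hx
  exact ⟨g.hom, congrArg ModuleCat.Hom.hom ((Abelian.Ext.mk₀_bijective _ _).1 hx)⟩

end Lifting

/-! ### Torsion theories and minimal presentations -/

section TorsionTheory

variable {A : Type u} [Ring A] {𝒳 𝒴 : ObjectProperty (ModuleCat.{u} A)}

theorem IsTorsionTheory.left_of_surjective (h : IsTorsionTheory 𝒳 𝒴) {M N : ModuleCat.{u} A}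
    (hM : 𝒳 M) (f : M →ₗ[A] N) (hf : Function.Surjective f) : 𝒳 N := by
  have := h.finite_left M hM
  exact h.factor (ModuleCat.ofHom f) ((ModuleCat.epi_iff_surjective _).2 hf) hM
    (Module.Finite.of_surjective f hf)

theorem IsTorsionTheory.right_of_injective [IsNoetherianRing A] (h : IsTorsionTheory 𝒳 𝒴)
    {M N : ModuleCat.{u} A} (hN : 𝒴 N) (f : M →ₗ[A] N) (hf : Function.Injective f) : 𝒴 M := by
  have := h.finite_right N hN
  exact h.sub (ModuleCat.ofHom f) ((ModuleCat.mono_iff_injective _).2 hf) hN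
    (Module.Finite.of_injective f hf)

theorem IsTorsionTheory.hom_eq_zero (h : IsTorsionTheory 𝒳 𝒴) {M N : ModuleCat.{u} A}
    (hM : 𝒳 M) (hN : 𝒴 N) (f : M →ₗ[A] N) : f = 0 := by
  have h1 : 𝒳 (ModuleCat.of A (LinearMap.range f)) :=
    h.left_of_surjective hM f.rangeRestrict f.surjective_rangeRestrict
  have h2 : 𝒴 (ModuleCat.of A (LinearMap.range f)) :=
    h.sub (ModuleCat.ofHom (LinearMap.range f).subtype)
      ((ModuleCat.mono_iff_injective _).2 (Submodule.injective_subtype _)) hN (h.finite_left _ h1)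
  have h3 := ModuleCat.isZero_iff_subsingleton.1 ((h.inter _).1 ⟨h1, h2⟩)
  ext x
  exact congrArg Subtype.val (h3.elim ⟨f x, x, rfl⟩ 0)

/-- The torsion-free quotient of `M` embeds into a product of copies of `Y`, so the projection onto
it vanishes and `M` is an image of its torsion part. -/
theorem IsTorsionTheory.left_of_forall_hom_eq_zero (h : IsTorsionTheory 𝒳 𝒴)
    {Y : ModuleCat.{u} A} (hYc : Cogenerates Y 𝒴) {M : ModuleCat.{u} A}
    [Module.Finite A M] (hM : ∀ f : M →ₗ[A] Y, f = 0) : 𝒳 M := by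
  obtain ⟨M', M'', i, p, w, hS, h', h''⟩ := h.exact M inferInstance
  obtain ⟨Λ, f, hf⟩ := hYc M'' h''
  have hp : p.hom = 0 := by
    ext x
    apply hf
    ext k
    rw [LinearMap.zero_apply, map_zero]
    exact LinearMap.congr_fun (hM (LinearMap.proj k ∘ₗ f ∘ₗ p.hom)) x
  refine h.left_of_surjective h' i.hom fun x => ?_
  exact ((ShortComplex.ShortExact.moduleCat_exact_iff_function_exact _).1 hS.exact x).1
    (LinearMap.congr_fun hp x)

theorem IsTorsionTheory.right_of_forall_hom_eq_zero [IsNoetherianRing A]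
    (h : IsTorsionTheory 𝒳 𝒴)
    {X : ModuleCat.{u} A} (hXg : Generates X 𝒳) {M : ModuleCat.{u} A}
    [Module.Finite A M] (hM : ∀ f : X →ₗ[A] M, f = 0) : 𝒴 M := by
  obtain ⟨M', M'', i, p, w, hS, h', h''⟩ := h.exact M inferInstance
  obtain ⟨Λ, f, hf⟩ := hXg M' h'
  have hi : i.hom ∘ₗ f = 0 := by
    apply Finsupp.lhom_ext'
    intro k
    rw [LinearMap.comp_assoc, LinearMap.zero_comp]
    exact hM (i.hom ∘ₗ f ∘ₗ Finsupp.lsingle k)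
  refine h.right_of_injective h'' p.hom ?_
  rw [injective_iff_map_eq_zero]
  intro x hx
  obtain ⟨y, rfl⟩ := ((ShortComplex.ShortExact.moduleCat_exact_iff_function_exact _).1 hS.exact x).1
    hx
  obtain ⟨z, rfl⟩ := hf y
  exact LinearMap.congr_fun hi z

/-- Maps from the first term of a minimal projective presentation of `X` to modules in `𝒳` extend
along the differential. -/
theorem IsTorsionTheory.exists_comp_eq_of_minimalProjectivePresentation
    (h : IsTorsionTheory 𝒳 𝒴) {X P₁ P₀ : ModuleCat.{u} A} (hX : IsExtProjective 𝒳 X)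
    {d : P₁ ⟶ P₀} {ε : P₀ ⟶ X} (hd : IsMinimalProjectivePresentation d ε)
    {M : ModuleCat.{u} A} (hM : 𝒳 M) (f : P₁ →ₗ[A] M) : ∃ g : P₀ →ₗ[A] M, g ∘ₗ d.hom = f := by
  obtain ⟨⟨hP₀, hε, -⟩, hdε, -, hd', hmin⟩ := hd
  set d' := LinearMap.codRestrict (LinearMap.ker ε.hom) d.hom hdε with hd'def
  have hd0 : ∀ x, d' x = 0 ↔ d.hom x = 0 := fun x => by
    rw [hd'def, Subtype.ext_iff]
    rfl
  -- The map `f` need not factor through `Ker ε`, but it does modulo `N`; the quotient `M ⧸ N` is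
  -- still in `𝒳`, so Ext vanishes there.
  let N : Submodule A M := (LinearMap.ker d').map f
  have hN : 𝒳 (ModuleCat.of A (M ⧸ N)) := h.left_of_surjective hM N.mkQ N.mkQ_surjective
  obtain ⟨f', hf'⟩ := exists_comp_eq_of_surjective d' hd' (N.mkQ ∘ₗ f) fun x hx =>
    (Submodule.Quotient.mk_eq_zero N).2 ⟨x, hx, rfl⟩
  obtain ⟨g₀, hg₀⟩ := exists_extension_of_ext_eq_zero X (ModuleCat.of A (M ⧸ N)) P₀
    (hX.2 _ hN) ε.hom hε f'
  obtain ⟨g, hg⟩ := Module.projective_lifting_property N.mkQ g₀ N.mkQ_surjective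
  refine ⟨g, ?_⟩
  have he : ∀ x, f x - g (d.hom x) ∈ N := by
    intro x
    rw [← Submodule.Quotient.mk_eq_zero, Submodule.Quotient.mk_sub, sub_eq_zero]
    have h1 := LinearMap.congr_fun hf' x
    have h2 := LinearMap.congr_fun hg₀ (d' x)
    have h3 := LinearMap.congr_fun hg (d.hom x)
    exact (h1.symm.trans h2.symm).trans h3.symm
  -- The error `f - g ∘ d` has values in `f (Ker d')` and agrees with `f` on `Ker d'`. Hence its
  -- kernel together with the superfluous `Ker d'` spans `P₁`.
  have hker : LinearMap.ker (f - g ∘ₗ d.hom) = ⊤ := by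
    apply hmin
    rw [eq_top_iff]
    intro x _
    obtain ⟨l, hl, hlx⟩ := he x
    have hl0 := (hd0 l).1 hl
    rw [← sub_add_cancel x l]
    refine Submodule.add_mem_sup ?_ hl
    simp [hl0, hlx]
  rw [LinearMap.ker_eq_top, sub_eq_zero] at hker
  exact hker.symm

/-- Maps from modules in `𝒴` to the last term of a minimal injective presentation of `Y` lift along
the differential. -/
theorem IsTorsionTheory.exists_comp_eq_of_minimalInjectivePresentation [IsNoetherianRing A]
    (h : IsTorsionTheory 𝒳 𝒴) {Y E₀ E₁ : ModuleCat.{u} A} (hY : IsExtInjective 𝒴 Y)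
    {η : Y ⟶ E₀} {δ : E₀ ⟶ E₁} (hδ : IsMinimalInjectivePresentation η δ)
    {M : ModuleCat.{u} A} (hM : 𝒴 M) (f : M →ₗ[A] E₁) : ∃ g : M →ₗ[A] E₀, δ.hom ∘ₗ g = f := by
  obtain ⟨⟨hE₀, hη, -⟩, hle, -, hδ', hmin⟩ := hδ
  -- Ext-injectivity of `Y` lifts `f` only where it lands in `Im δ`; injectivity of `E₀` then
  -- extends the lift to `M`.
  let M' : Submodule A M := (LinearMap.range δ.hom).comap f
  have hM' : 𝒴 (ModuleCat.of A M') := h.right_of_injective hM M'.subtype M'.injective_subtype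
  have hex : Function.Exact η.hom δ.hom.rangeRestrict := by
    intro x
    rw [Subtype.ext_iff]
    constructor
    · intro hx
      have : (Submodule.Quotient.mk x : E₀ ⧸ LinearMap.range η.hom) = 0 := by
        apply hδ'
        rw [map_zero, Submodule.liftQ_apply]
        exact hx
      exact (Submodule.Quotient.mk_eq_zero _).1 this
    · exact fun hx => hle hx
  obtain ⟨g₀, hg₀⟩ := exists_lift_of_ext_eq_zero (ModuleCat.of A M') Y E₀
    (ModuleCat.of A (LinearMap.range δ.hom)) (hY.2 _ hM') η.hom δ.hom.rangeRestrict hη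
    δ.hom.surjective_rangeRestrict hex (f.restrict fun x hx => hx)
  obtain ⟨g, hg⟩ := hE₀.out M'.subtype M'.injective_subtype g₀
  refine ⟨g, ?_⟩
  have he : ∀ x ∈ M', f x - δ.hom (g x) = 0 := by
    intro x hx
    have h1 := congrArg Subtype.val (LinearMap.congr_fun hg₀ ⟨x, hx⟩)
    have h2 := hg ⟨x, hx⟩
    rw [sub_eq_zero]
    refine h1.symm.trans ?_
    rw [Submodule.subtype_apply] at h2
    rw [h2]
    rfl
  -- If `(f - δ ∘ g) x` lies in `Im δ`, then so does `f x`; thus `x ∈ M'` and the value is zero.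
  -- Since `Im δ` is essential in `E₁`, the error vanishes.
  have hr : LinearMap.range (f - δ.hom ∘ₗ g) = ⊥ := by
    apply hmin
    rw [eq_bot_iff]
    rintro _ ⟨⟨x, rfl⟩, y, hy⟩
    obtain ⟨y, rfl⟩ := Submodule.Quotient.mk_surjective _ y
    rw [Submodule.liftQ_apply] at hy
    refine he x ⟨g x + y, ?_⟩
    rw [map_add, hy]
    simp
  rw [LinearMap.range_eq_bot, sub_eq_zero] at hr
  exact hr.symm

end TorsionTheory

/-! ### Tilting maps -/

section TiltingMap

variable {A : Type u} [Ring A]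

/-- A map `a : U → V`, regarded as a complex in degrees `-1` and `0`, such that `(𝒳, 𝒴)` is the pair
of classes it defines, without selfextensions and whose cokernel generates `𝒳`. -/
structure IsTiltingMap (𝒳 𝒴 : ObjectProperty (ModuleCat.{u} A)) {U V : Type u} [AddCommGroup U]
    [Module A U] [AddCommGroup V] [Module A V] (a : U →ₗ[A] V) : Prop where
  left_iff : ∀ M : ModuleCat.{u} A, 𝒳 M ↔
    Module.Finite A M ∧ ∀ f : U →ₗ[A] M, ∃ g : V →ₗ[A] M, g ∘ₗ a = f
  right_iff : ∀ M : ModuleCat.{u} A, 𝒴 M ↔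
    Module.Finite A M ∧ ∀ g : V →ₗ[A] M, g ∘ₗ a = 0 → g = 0
  exists_eq_add : ∀ t : U →ₗ[A] V, ∃ (s : U →ₗ[A] U) (s' : V →ₗ[A] V), t = a ∘ₗ s + s' ∘ₗ a
  eq_zero : ∀ h : V →ₗ[A] U, a ∘ₗ h = 0 → h ∘ₗ a = 0 → h = 0
  generates : ∀ M : ModuleCat.{u} A, 𝒳 M → ∀ N : Submodule A M,
    (∀ g : V →ₗ[A] M, g ∘ₗ a = 0 → LinearMap.range g ≤ N) → N = ⊤

/-- If the cokernel of `a` belongs to the first class, then `a` has no selfextensions. -/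
theorem exists_eq_add_of_forall_exists_comp_eq {U V : Type u} [AddCommGroup U]
    [Module A U] [AddCommGroup V] [Module A V] [Module.Projective A U] [Module.Projective A V]
    (a : U →ₗ[A] V)
    (h : ∀ f : U →ₗ[A] V ⧸ LinearMap.range a, ∃ g : V →ₗ[A] V ⧸ LinearMap.range a, g ∘ₗ a = f)
    (t : U →ₗ[A] V) : ∃ (s : U →ₗ[A] U) (s' : V →ₗ[A] V), t = a ∘ₗ s + s' ∘ₗ a := by
  obtain ⟨g, hg⟩ := h ((LinearMap.range a).mkQ ∘ₗ t)
  obtain ⟨s', hs'⟩ := Module.projective_lifting_property (LinearMap.range a).mkQ g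
    (Submodule.mkQ_surjective _)
  have h1 : ∀ x, (t - s' ∘ₗ a) x ∈ LinearMap.range a := by
    intro x
    rw [← Submodule.Quotient.mk_eq_zero, LinearMap.sub_apply, Submodule.Quotient.mk_sub, sub_eq_zero]
    exact (LinearMap.congr_fun hg x).symm.trans (LinearMap.congr_fun hs' (a x)).symm
  obtain ⟨s, hs⟩ := Module.projective_lifting_property a.rangeRestrict
    (LinearMap.codRestrict _ _ h1) a.surjective_rangeRestrict
  refine ⟨s, s', ?_⟩
  rw [← sub_eq_iff_eq_add]
  ext x
  exact (congrArg Subtype.val (LinearMap.congr_fun hs x)).symm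

/-- The hypothesis `right` gives `Hom(Coker a, Y) = 0` and `ker` gives `Hom(X, Ker a) = 0`, so
`Coker a` is in `𝒳` and `Ker a` is in `𝒴`. A map `V → U` annihilated by `a` on both sides is a map
`Coker a → Ker a`, hence zero; generation holds because `Coker a` maps onto `X`. -/
theorem IsTorsionTheory.isTiltingMap [IsNoetherianRing A]
    {𝒳 𝒴 : ObjectProperty (ModuleCat.{u} A)} (h : IsTorsionTheory 𝒳 𝒴) {X Y : ModuleCat.{u} A}
    (hXg : Generates X 𝒳) (hY : 𝒴 Y) (hYc : Cogenerates Y 𝒴)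
    {U V : Type u} [AddCommGroup U] [Module A U] [AddCommGroup V] [Module A V]
    [Module.Finite A U] [Module.Projective A U] [Module.Finite A V] [Module.Projective A V]
    (a : U →ₗ[A] V) (ε : V →ₗ[A] X) (hε : Function.Surjective ε) (hεa : ε ∘ₗ a = 0)
    (left : ∀ M : ModuleCat.{u} A, 𝒳 M → ∀ f : U →ₗ[A] M, ∃ g : V →ₗ[A] M, g ∘ₗ a = f)
    (left' : ∀ M : ModuleCat.{u} A, (∀ f : U →ₗ[A] M, ∃ g : V →ₗ[A] M, g ∘ₗ a = f) →
      ∀ f : M →ₗ[A] Y, f = 0)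
    (right : ∀ M : ModuleCat.{u} A, 𝒴 M → ∀ g : V →ₗ[A] M, g ∘ₗ a = 0 → g = 0)
    (ker : ∀ u : X →ₗ[A] U, a ∘ₗ u = 0 → u = 0) : IsTiltingMap 𝒳 𝒴 a := by
  have hcok : 𝒳 (ModuleCat.of A (V ⧸ LinearMap.range a)) := by
    refine h.left_of_forall_hom_eq_zero hYc fun f => ?_
    have := right Y hY (f ∘ₗ (LinearMap.range a).mkQ) (by
      rw [LinearMap.comp_assoc, LinearMap.range_mkQ_comp, LinearMap.comp_zero])
    ext x
    exact LinearMap.congr_fun this x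
  have hker : 𝒴 (ModuleCat.of A (LinearMap.ker a)) := by
    refine h.right_of_forall_hom_eq_zero hXg fun f => ?_
    have := ker ((LinearMap.ker a).subtype ∘ₗ f) (by
      rw [← LinearMap.comp_assoc, LinearMap.comp_ker_subtype, LinearMap.zero_comp])
    ext x
    exact LinearMap.congr_fun this x
  refine ⟨fun M => ⟨fun hM => ⟨h.finite_left M hM, left M hM⟩, fun ⟨hf, hM⟩ =>
    h.left_of_forall_hom_eq_zero hYc (left' M hM)⟩, fun M => ⟨fun hM => ⟨h.finite_right M hM,
    right M hM⟩, fun ⟨hf, hM⟩ => h.right_of_forall_hom_eq_zero hXg fun f => ?_⟩,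
    exists_eq_add_of_forall_exists_comp_eq a (left _ hcok), fun g hg hg' => ?_, fun M hM N hN => ?_⟩
  · have := hM (f ∘ₗ ε) (by rw [LinearMap.comp_assoc, hεa, LinearMap.comp_zero])
    ext x
    obtain ⟨v, rfl⟩ := hε x
    exact LinearMap.congr_fun this v
  · let g' : V ⧸ LinearMap.range a →ₗ[A] LinearMap.ker a :=
      (LinearMap.range a).liftQ (LinearMap.codRestrict (LinearMap.ker a) g
        fun x => LinearMap.congr_fun hg x) (by
          rintro _ ⟨x, rfl⟩
          exact Subtype.ext (LinearMap.congr_fun hg' x))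
    have : g' = 0 := h.hom_eq_zero hcok hker g'
    ext v
    exact congrArg Subtype.val (LinearMap.congr_fun this (Submodule.Quotient.mk v))
  · obtain ⟨Λ, f, hf⟩ := hXg M hM
    rw [eq_top_iff]
    intro m _
    obtain ⟨z, rfl⟩ := hf m
    induction z using Finsupp.induction_linear with
    | zero => simp
    | add z z' hz hz' =>
      rw [map_add]
      exact N.add_mem (hz trivial) (hz' trivial)
    | single k x =>
      obtain ⟨v, rfl⟩ := hε x
      exact hN (f ∘ₗ Finsupp.lsingle k ∘ₗ ε) (by
        rw [LinearMap.comp_assoc, LinearMap.comp_assoc, hεa, LinearMap.comp_zero,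
          LinearMap.comp_zero]) ⟨v, rfl⟩

end TiltingMap

/-! ### The differential of the presentation complex is a tilting map -/

section Block

variable {R A I : Type u} [CommRing R] [IsArtinianRing R] [Ring A] [Algebra R A]
  [Module.Finite R A] [AddCommGroup I] [Module R I]
  {ι : (R ⧸ Ring.jacobson R) →ₗ[R] I}

/-- The differential of the complex attached to presentations of `X` and `Y`. -/
theorem IsTorsionTheory.isTiltingMap_prodMap [IsNoetherianRing A] (hι : IsInjectiveEnvelope ι)
    {𝒳 𝒴 : ObjectProperty (ModuleCat.{u} A)} (h : IsTorsionTheory 𝒳 𝒴)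
    {X Y : ModuleCat.{u} A} (hX : IsExtProjective 𝒳 X) (hXgen : Generates X 𝒳)
    (hY : IsExtInjective 𝒴 Y) (hYcogen : Cogenerates Y 𝒴)
    (hstable : ∀ M, 𝒳 M → 𝒳 (dualTensor R A I M))
    {P₁ P₀ E₀ E₁ : ModuleCat.{u} A} [Module.Finite A P₁] [Module.Finite A P₀]
    (D₀ : DualSummand R A I E₀) (D₁ : DualSummand R A I E₁) {d : P₁ ⟶ P₀} {ε : P₀ ⟶ X}
    (hd : IsMinimalProjectivePresentation d ε)
    {η : Y ⟶ E₀} {δ : E₀ ⟶ E₁} (hδ : IsMinimalInjectivePresentation η δ) :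
    IsTiltingMap 𝒳 𝒴 (d.hom.prodMap (dualHomMap (R := R) (I := I) δ.hom)) := by
  have hP₁ : Module.Projective A P₁ := hd.2.2.1
  have hP₀ : Module.Projective A P₀ := hd.1.1
  have := D₀.finite_dualHom hι
  have := D₁.finite_dualHom hι
  have := D₀.projective_dualHom hι
  have := D₁.projective_dualHom hι
  have hεd : ε.hom ∘ₗ d.hom = 0 := LinearMap.ext hd.2.1
  have hδη : δ.hom ∘ₗ η.hom = 0 := by
    ext y
    exact hδ.2.1 ⟨y, rfl⟩
  have hkerδ : ∀ x, δ.hom x = 0 → x ∈ LinearMap.range η.hom := by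
    intro x hx
    have : (Submodule.Quotient.mk x : E₀ ⧸ LinearMap.range η.hom) = 0 := by
      apply hδ.2.2.2.1
      rw [map_zero, Submodule.liftQ_apply]
      exact hx
    exact (Submodule.Quotient.mk_eq_zero _).1 this
  let e : Y ≃ₗ[A] LinearMap.range η.hom := LinearEquiv.ofInjective η.hom hδ.1.2.1
  have hYker : 𝒴 (ModuleCat.of A (LinearMap.ker δ.hom)) :=
    h.right_of_injective hY.1 (e.symm.toLinearMap ∘ₗ Submodule.inclusion hkerδ)
      (e.symm.injective.comp (Submodule.inclusion_injective _))
  have hzero : ∀ {M : ModuleCat.{u} A}, (∀ f : M →ₗ[A] Y, f = 0) →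
      ∀ f : M →ₗ[A] E₀, δ.hom ∘ₗ f = 0 → f = 0 := by
    intro M hM f hf
    have := hM (e.symm.toLinearMap ∘ₗ LinearMap.codRestrict _ f
      fun x => hkerδ _ (LinearMap.congr_fun hf x))
    ext x
    have := e.symm.injective ((LinearMap.congr_fun this x).trans (map_zero e.symm).symm)
    exact congrArg Subtype.val this
  refine h.isTiltingMap hXgen hY.1 hYcogen _ (ε.hom ∘ₗ LinearMap.fst A _ _)
    (hd.1.2.1.comp LinearMap.fst_surjective) ?_ ?_ ?_ ?_ ?_
  · ext x
    · exact LinearMap.congr_fun hεd x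
    · simp
  · intro M hM f
    let _ := Module.compHom M (algebraMap R A)
    have : IsScalarTower R A M := ⟨fun r a x => by rw [Algebra.smul_def, mul_smul]; rfl⟩
    obtain ⟨g₁, hg₁⟩ := h.exists_comp_eq_of_minimalProjectivePresentation hX hd hM
      (f ∘ₗ LinearMap.inl A _ _)
    obtain ⟨g₂, hg₂⟩ := (forall_exists_comp_dualHomMap_iff (M := M) hι D₀ D₁ δ.hom).2
      (hzero (h.hom_eq_zero hM hY.1)) (f ∘ₗ LinearMap.inr A _ _)
    refine ⟨g₁.coprod g₂, ?_⟩
    ext x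
    · simpa using LinearMap.congr_fun hg₁ x
    · simpa using LinearMap.congr_fun hg₂ x
  · intro M hM f
    let _ := Module.compHom M (algebraMap R A)
    have : IsScalarTower R A M := ⟨fun r a x => by rw [Algebra.smul_def, mul_smul]; rfl⟩
    have h1 : η.hom ∘ₗ f = 0 := by
      refine (forall_exists_comp_dualHomMap_iff (M := M) hι D₀ D₁ δ.hom).1 ?_ _ (by
        rw [← LinearMap.comp_assoc, hδη, LinearMap.zero_comp])
      intro g
      obtain ⟨g', hg'⟩ := hM (g ∘ₗ LinearMap.snd A _ _)
      refine ⟨g' ∘ₗ LinearMap.inr A _ _, ?_⟩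
      ext1 q
      have := LinearMap.congr_fun hg' (0, q)
      simpa using this
    ext x
    exact hδ.1.2.1 ((LinearMap.congr_fun h1 x).trans (map_zero η.hom).symm)
  · intro M hM g hg
    let _ := Module.compHom M (algebraMap R A)
    have : IsScalarTower R A M := ⟨fun r a x => by rw [Algebra.smul_def, mul_smul]; rfl⟩
    have h1 : g ∘ₗ LinearMap.inl A _ _ = 0 := by
      obtain ⟨g₁, hg₁⟩ := exists_comp_eq_of_surjective ε.hom hd.1.2.1 (g ∘ₗ LinearMap.inl A _ _)
        (fun x hx => by
          obtain ⟨y, hy⟩ := hd.2.2.2.1 ⟨x, hx⟩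
          have hy' : d.hom y = x := congrArg Subtype.val hy
          rw [← hy']
          simpa using LinearMap.congr_fun hg (y, 0))
      rw [← hg₁, h.hom_eq_zero hX.1 hM g₁, LinearMap.zero_comp]
    have h2 : g ∘ₗ LinearMap.inr A _ _ = 0 := by
      refine eq_zero_of_comp_dualHomMap_eq_zero (M := M) hι D₀ D₁ δ.hom
        (h.exists_comp_eq_of_minimalInjectivePresentation hY hδ hM) _ ?_
      ext1 q
      simpa using LinearMap.congr_fun hg (0, q)
    rw [← g.coprod_comp_inl_inr, h1, h2]
    ext <;> simp
  · intro u hu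
    -- As `DA ⊗ X` is in `𝒳`, maps `P₁ → DA ⊗ X` extend along `d`; dually, composition with `d` is
    -- injective on `Hom(X, P₁)`.
    have h1 : LinearMap.fst A _ _ ∘ₗ u = 0 :=
      eq_zero_of_forall_exists_comp_eq hι d.hom
        (h.exists_comp_eq_of_minimalProjectivePresentation hX hd (hstable X hX.1)) _ (by
          ext x
          exact congrArg Prod.fst (LinearMap.congr_fun hu x))
    -- This component takes values in `Hom_A(DA, Ker δ)`. By adjunction it comes from a map `DA ⊗ X
    -- → Ker δ`, from a module in `𝒳` to one in `𝒴`.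
    have h2 : LinearMap.snd A _ _ ∘ₗ u = 0 := by
      have hv : ∀ x f, δ.hom ((u x).2 f) = 0 := fun x f =>
        LinearMap.congr_fun (congrArg Prod.snd (LinearMap.congr_fun hu x)) f
      let v : X →ₗ[A] Dual R A I →ₗ[A] LinearMap.ker δ.hom :=
        { toFun := fun x => LinearMap.codRestrict _ (u x).2 (hv x)
          map_add' := fun x y => by
            ext f
            exact LinearMap.congr_fun (congrArg Prod.snd (map_add u x y)) f
          map_smul' := fun a x => by
            ext f
            exact LinearMap.congr_fun (congrArg Prod.snd (map_smul u a x)) f }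
      have hv0 : v = 0 := eq_zero_of_forall_dualTensor_eq_zero
        (h.hom_eq_zero (hstable X hX.1) hYker) v
      ext x f
      exact congrArg Subtype.val (LinearMap.congr_fun (LinearMap.congr_fun hv0 x) f)
    ext x
    · exact LinearMap.congr_fun h1 x
    · exact LinearMap.congr_fun (LinearMap.congr_fun h2 x) _

end Block

/-! ### Finite generation of morphisms between maps -/

section Generators

variable {A : Type u} [Ring A]

theorem projective_pi_fin (n : ℕ) (M : Type*) [AddCommGroup M] [Module A M]
    [Module.Projective A M] : Module.Projective A (Fin n → M) :=
  Module.Projective.of_equiv (DFinsupp.linearEquivFunOnFintype (R := A) (M := fun _ : Fin n => M))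

theorem isNoetherian_linearMap (R : Type*) {M N : Type*} [CommRing R] [Algebra R A]
    [AddCommGroup M] [Module A M] [AddCommGroup N] [Module A N] [Module R N] [IsScalarTower R A N]
    [IsNoetherian R N] [Module.Finite A M] : IsNoetherian R (M →ₗ[A] N) := by
  obtain ⟨n, e, he⟩ := Module.Finite.exists_fin (R := A) (M := M)
  refine isNoetherian_of_injective (R := R)
    ({ toFun := fun f k => f (e k), map_add' := fun _ _ => rfl, map_smul' := fun _ _ => rfl } :
      (M →ₗ[A] N) →ₗ[R] Fin n → N) fun f g hfg => ?_
  refine LinearMap.ext_on_range he fun k => congrFun hfg k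

/-- Morphisms between maps of finitely generated modules over an artin algebra are finitely
generated over the endomorphisms of the source. -/
theorem exists_generators (R : Type*) [CommRing R] [IsNoetherianRing R] [Algebra R A]
    [Module.Finite R A] {U V C₁ C₀ : Type*} [AddCommGroup U] [Module A U] [AddCommGroup V]
    [Module A V] [AddCommGroup C₁] [Module A C₁] [AddCommGroup C₀] [Module A C₀]
    [Module.Finite A U] [Module.Finite A V] [Module.Finite A C₁] [Module.Finite A C₀]
    (a : U →ₗ[A] V) (q : C₁ →ₗ[A] C₀) :
    ∃ (m : ℕ) (φ₁ : Fin m → U →ₗ[A] C₁) (φ₀ : Fin m → V →ₗ[A] C₀),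
      (∀ k, q ∘ₗ φ₁ k = φ₀ k ∘ₗ a) ∧
      ∀ (g₁ : U →ₗ[A] C₁) (g₀ : V →ₗ[A] C₀), q ∘ₗ g₁ = g₀ ∘ₗ a →
        ∃ (ρ : Fin m → U →ₗ[A] U) (ρ' : Fin m → V →ₗ[A] V), (∀ k, a ∘ₗ ρ k = ρ' k ∘ₗ a) ∧
          g₁ = ∑ k, φ₁ k ∘ₗ ρ k ∧ g₀ = ∑ k, φ₀ k ∘ₗ ρ' k := by
  let _ := Module.compHom U (algebraMap R A)
  let _ := Module.compHom V (algebraMap R A)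
  let _ := Module.compHom C₁ (algebraMap R A)
  let _ := Module.compHom C₀ (algebraMap R A)
  have : IsScalarTower R A U := ⟨fun r a x => by rw [Algebra.smul_def, mul_smul]; rfl⟩
  have : IsScalarTower R A V := ⟨fun r a x => by rw [Algebra.smul_def, mul_smul]; rfl⟩
  have : IsScalarTower R A C₁ := ⟨fun r a x => by rw [Algebra.smul_def, mul_smul]; rfl⟩
  have : IsScalarTower R A C₀ := ⟨fun r a x => by rw [Algebra.smul_def, mul_smul]; rfl⟩
  have : Module.Finite R C₁ := Module.Finite.trans A C₁
  have : Module.Finite R C₀ := Module.Finite.trans A C₀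
  have := isNoetherian_linearMap (A := A) R (M := U) (N := C₁)
  have := isNoetherian_linearMap (A := A) R (M := V) (N := C₀)
  let S : Submodule R ((U →ₗ[A] C₁) × (V →ₗ[A] C₀)) :=
    { carrier := {g | q ∘ₗ g.1 = g.2 ∘ₗ a}
      add_mem' := fun {g g'} hg hg' => by
        change q ∘ₗ (g.1 + g'.1) = (g.2 + g'.2) ∘ₗ a
        rw [LinearMap.comp_add, LinearMap.add_comp, hg, hg']
      zero_mem' := by
        change q ∘ₗ 0 = 0 ∘ₗ a
        rw [LinearMap.comp_zero, LinearMap.zero_comp]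
      smul_mem' := fun r g hg => by
        change q ∘ₗ (r • g.1) = (r • g.2) ∘ₗ a
        rw [LinearMap.smul_comp, ← hg]
        ext x
        simp [LinearMap.map_smul_of_tower] }
  obtain ⟨m, φ, hφ⟩ := Module.Finite.exists_fin (R := R) (M := S)
  refine ⟨m, fun k => (φ k).1.1, fun k => (φ k).1.2, fun k => (φ k).2, fun g₁ g₀ hg => ?_⟩
  have h1 : (⟨(g₁, g₀), hg⟩ : S) ∈ Submodule.span R (Set.range φ) := hφ ▸ Submodule.mem_top
  obtain ⟨r, hr⟩ := (Submodule.mem_span_range_iff_exists_fun R).1 h1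
  have hr' := congrArg Subtype.val hr
  -- Generators over `R` already suffice: scalars of `R` act as endomorphisms of `a`.
  refine ⟨fun k => r k • LinearMap.id, fun k => r k • LinearMap.id, fun k => ?_, ?_, ?_⟩
  · ext x
    simp [LinearMap.map_smul_of_tower]
  · refine Eq.trans (congrArg Prod.fst hr').symm ?_
    ext x
    simp [Prod.fst_sum, LinearMap.map_smul_of_tower]
  · refine Eq.trans (congrArg Prod.snd hr').symm ?_
    ext x
    simp [Prod.snd_sum, LinearMap.map_smul_of_tower]

end Generators

/-! ### Universal extensions as homotopy retracts -/

section Retract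

variable {A : Type u} [Ring A] {U V B : Type u} [AddCommGroup U] [Module A U] [AddCommGroup V]
  [Module A V] [AddCommGroup B] [Module A B]

/-- The differential of the extension of `n` copies of `a` by `B` given by the maps `h k`. -/
noncomputable def extMap (a : U →ₗ[A] V) {n : ℕ} (h : Fin n → U →ₗ[A] B) :
    (Fin n → U) →ₗ[A] B × (Fin n → V) :=
  (∑ k, h k ∘ₗ LinearMap.proj k).prod (LinearMap.pi fun k => a ∘ₗ LinearMap.proj k)

theorem extMap_fst (a : U →ₗ[A] V) {n : ℕ} (h : Fin n → U →ₗ[A] B) (x : Fin n → U) :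
    (extMap a h x).1 = ∑ k, h k (x k) := by
  simp [extMap]

theorem extMap_snd (a : U →ₗ[A] V) {n : ℕ} (h : Fin n → U →ₗ[A] B) (x : Fin n → U) (k : Fin n) :
    (extMap a h x).2 k = a (x k) := by
  simp [extMap]

theorem IsTiltingMap.exists_comp_extMap_eq {𝒳 𝒴 : ObjectProperty (ModuleCat.{u} A)}
    {a : U →ₗ[A] V} (ha : IsTiltingMap 𝒳 𝒴 a) {n : ℕ} (h : Fin n → U →ₗ[A] B)
    {M : ModuleCat.{u} A} (hM : 𝒳 M) (f : (Fin n → U) →ₗ[A] M) :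
    ∃ g : B × (Fin n → V) →ₗ[A] M, g ∘ₗ extMap a h = f := by
  choose g hg using fun k => ((ha.left_iff M).1 hM).2 (f ∘ₗ LinearMap.single A (fun _ => U) k)
  refine ⟨(∑ k, g k ∘ₗ LinearMap.proj k) ∘ₗ LinearMap.snd A B _, LinearMap.ext fun x => ?_⟩
  simp only [LinearMap.comp_apply, LinearMap.snd_apply, LinearMap.coe_sum, Finset.sum_apply,
    LinearMap.proj_apply, extMap_snd]
  have : ∀ k, g k (a (x k)) = f (Pi.single k (x k)) := fun k => LinearMap.congr_fun (hg k) (x k)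
  simp only [this, ← map_sum]
  rw [Finset.univ_sum_single]

variable [Module.Projective A U] [Module.Finite A V] [Module.Finite A B]

/-- The cokernel of `extMap` belongs to the first class. -/
theorem IsTiltingMap.coker_extMap {𝒳 𝒴 : ObjectProperty (ModuleCat.{u} A)}
    {a : U →ₗ[A] V} (ha : IsTiltingMap 𝒳 𝒴 a) {n : ℕ} (h : Fin n → U →ₗ[A] B)
    (hh : ∀ f : U →ₗ[A] B, ∃ (ρ : Fin n → U →ₗ[A] U) (ρ' : Fin n → V →ₗ[A] V),
      (∀ k, a ∘ₗ ρ k = ρ' k ∘ₗ a) ∧ f = ∑ k, h k ∘ₗ ρ k) :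
    𝒳 (ModuleCat.of A ((B × (Fin n → V)) ⧸ LinearMap.range (extMap a h))) := by
  rw [ha.left_iff]
  refine ⟨inferInstanceAs (Module.Finite A (_ ⧸ _)), fun f => ?_⟩
  obtain ⟨t, ht⟩ := Module.projective_lifting_property (LinearMap.range (extMap a h)).mkQ f
    (Submodule.mkQ_surjective _)
  obtain ⟨ρ, ρ', hρ, e1⟩ := hh (LinearMap.fst A _ _ ∘ₗ t)
  choose s s' hs using fun k => ha.exists_eq_add (LinearMap.proj k ∘ₗ LinearMap.snd A _ _ ∘ₗ t)
  -- Removing the `a ∘ s k` by an element of the image of `extMap a h` disturbs the component in `B`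
  -- by `∑ h k ∘ s k`; the endomorphisms `σ` undo this.
  obtain ⟨σ, σ', hσ, e2⟩ := hh (∑ k, h k ∘ₗ s k)
  refine ⟨(LinearMap.range (extMap a h)).mkQ ∘ₗ LinearMap.inr A _ _ ∘ₗ
    LinearMap.pi fun k => s' k - ρ' k + σ' k, ?_⟩
  rw [← ht]
  ext x
  simp only [LinearMap.comp_apply, Submodule.mkQ_apply]
  refine ((Submodule.Quotient.eq (LinearMap.range (extMap a h))).2 ⟨fun k => ρ k x + s k x - σ k x, ?_⟩).symm
  refine Prod.ext ?_ (funext fun k => ?_)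
  · have h1 := LinearMap.congr_fun e1 x
    have h2 := LinearMap.congr_fun e2 x
    simp only [LinearMap.coe_sum, Finset.sum_apply, LinearMap.comp_apply,
      LinearMap.fst_apply] at h1 h2
    rw [extMap_fst]
    simp only [map_add, map_sub, Finset.sum_add_distrib, Finset.sum_sub_distrib, h2]
    simp [h1]
  · have h1 := LinearMap.congr_fun (hs k) x
    have h2 := LinearMap.congr_fun (hρ k) x
    have h3 := LinearMap.congr_fun (hσ k) x
    simp only [LinearMap.add_apply, LinearMap.comp_apply, LinearMap.snd_apply,
      LinearMap.proj_apply] at h1 h2 h3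
    rw [extMap_snd]
    simp only [map_add, map_sub, h2, h3, Prod.snd_sub, Pi.sub_apply, h1, LinearMap.inr_apply,
      LinearMap.pi_apply, LinearMap.add_apply, LinearMap.sub_apply]
    abel

variable [Module.Finite A U] [Module.Projective A V]

/-- Each finitely generated projective module `B` has an extension by copies of `a` which is a
homotopy retract of a sum of copies of `a`. -/
theorem IsTiltingMap.exists_retract (R : Type*) [CommRing R] [IsNoetherianRing R] [Algebra R A]
    [Module.Finite R A] [IsNoetherianRing A] {𝒳 𝒴 : ObjectProperty (ModuleCat.{u} A)}
    {a : U →ₗ[A] V} (ha : IsTiltingMap 𝒳 𝒴 a) [Module.Projective A B] :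
    ∃ (n : ℕ) (h : Fin n → U →ₗ[A] B) (m : ℕ) (φ₁ : Fin m → U →ₗ[A] (Fin n → U))
      (φ₀ : Fin m → V →ₗ[A] B × (Fin n → V)) (w : Fin m → (Fin n → U) →ₗ[A] U)
      (s : Fin m → B × (Fin n → V) →ₗ[A] V) (t : B × (Fin n → V) →ₗ[A] (Fin n → U)),
      (∀ k, extMap a h ∘ₗ φ₁ k = φ₀ k ∘ₗ a) ∧ (∀ k, s k ∘ₗ extMap a h = a ∘ₗ w k) ∧
      (∀ x, t (extMap a h x) + ∑ k, φ₁ k (w k x) = x) ∧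
      ∀ y, extMap a h (t y) + ∑ k, φ₀ k (s k y) = y := by
  have hpi := projective_pi_fin (A := A)
  -- With zero target in degree `0`, morphisms from `a` are just maps `U → B`.
  obtain ⟨n, h, h₀, -, hh⟩ := exists_generators R a (0 : B →ₗ[A] PUnit.{u + 1})
  replace hh : ∀ f : U →ₗ[A] B, ∃ (ρ : Fin n → U →ₗ[A] U) (ρ' : Fin n → V →ₗ[A] V),
      (∀ k, a ∘ₗ ρ k = ρ' k ∘ₗ a) ∧ f = ∑ k, h k ∘ₗ ρ k := fun f => by
    obtain ⟨ρ, ρ', h1, h2, -⟩ := hh f 0 (Subsingleton.elim _ _)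
    exact ⟨ρ, ρ', h1, h2⟩
  have hcok := ha.coker_extMap h hh
  set q := extMap a h with hq
  obtain ⟨m, φ₁, φ₀, hφ, hgen⟩ := exists_generators R a q
  let Φ₁ : (Fin m → U) →ₗ[A] (Fin n → U) := ∑ k, φ₁ k ∘ₗ LinearMap.proj k
  let Φ₀ : (Fin m → V) →ₗ[A] B × (Fin n → V) := ∑ k, φ₀ k ∘ₗ LinearMap.proj k
  have hΦ₁ : ∀ x, Φ₁ x = ∑ k, φ₁ k (x k) := fun x => by simp [Φ₁]
  have hΦ₀ : ∀ x, Φ₀ x = ∑ k, φ₀ k (x k) := fun x => by simp [Φ₀]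
  have hΦ : ∀ x : Fin m → U, q (Φ₁ x) = Φ₀ fun k => a (x k) := by
    intro x
    rw [hΦ₁, hΦ₀, map_sum]
    exact Finset.sum_congr rfl fun k _ => LinearMap.congr_fun (hφ k) (x k)
  -- `Ψ` and the later `β` are the differentials of the cone of the approximation `Φ` from `m`
  -- copies of `a` to `q`. The aim is a null homotopy of `q → Cone Φ`, which makes `q` a retract of
  -- these copies.
  let Ψ : (Fin m → V) × (Fin n → U) →ₗ[A] B × (Fin n → V) := Φ₀.coprod q
  have hΨ : ∀ x y, Ψ (x, y) = Φ₀ x + q y := fun x y => rfl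
  -- `Coker q` is in `𝒳`, hence generated by maps from `Coker a`. By projectivity these lift to
  -- morphisms `a → q`, which factor through `Φ`.
  have hsurj : Function.Surjective Ψ := by
    have htop := ha.generates _ hcok ((LinearMap.range Ψ).map (LinearMap.range q).mkQ) (by
      intro g hg
      obtain ⟨g₀, hg₀⟩ := Module.projective_lifting_property (LinearMap.range q).mkQ g
        (Submodule.mkQ_surjective _)
      have h1 : ∀ x, (g₀ ∘ₗ a) x ∈ LinearMap.range q := fun x => by
        rw [← Submodule.Quotient.mk_eq_zero]
        exact (LinearMap.congr_fun hg₀ (a x)).trans (LinearMap.congr_fun hg x)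
      obtain ⟨g₁, hg₁⟩ := Module.projective_lifting_property q.rangeRestrict
        (LinearMap.codRestrict _ _ h1) q.surjective_rangeRestrict
      obtain ⟨ρ, ρ', -, -, e⟩ := hgen g₁ g₀ (by
        ext1 x
        exact congrArg Subtype.val (LinearMap.congr_fun hg₁ x))
      rintro _ ⟨v, rfl⟩
      refine ⟨g₀ v, ⟨(fun k => ρ' k v, 0), ?_⟩, LinearMap.congr_fun hg₀ v⟩
      rw [hΨ, hΦ₀, e, map_zero, add_zero]
      simp)
    intro y
    have : (Submodule.Quotient.mk y : _ ⧸ LinearMap.range q) ∈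
        (LinearMap.range Ψ).map (LinearMap.range q).mkQ := htop ▸ Submodule.mem_top
    obtain ⟨_, ⟨⟨x, z⟩, rfl⟩, hy⟩ := this
    obtain ⟨z', hz'⟩ := (Submodule.Quotient.eq _).1 hy.symm
    refine ⟨(x, z + z'), ?_⟩
    rw [hΨ, map_add, hz', hΨ]
    abel
  have := hpi n V
  have := hpi n U
  obtain ⟨σ, hσ⟩ := Module.projective_lifting_property Ψ LinearMap.id hsurj
  let β : (Fin m → U) →ₗ[A] LinearMap.ker Ψ :=
    LinearMap.codRestrict _ ((LinearMap.pi fun k => a ∘ₗ LinearMap.proj k).prod (-Φ₁)) fun x => by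
      rw [LinearMap.mem_ker, LinearMap.prod_apply]
      change Φ₀ (fun k => a (x k)) + q (-Φ₁ x) = 0
      rw [map_neg, hΦ, add_neg_cancel]
  have hβ : ∀ x, (β x).1 = (fun k => a (x k), -Φ₁ x) := fun x => rfl
  have hH : 𝒳 (ModuleCat.of A (LinearMap.ker Ψ ⧸ LinearMap.range β)) := by
    rw [ha.left_iff]
    refine ⟨inferInstanceAs (Module.Finite A (_ ⧸ _)), fun f => ?_⟩
    obtain ⟨f', hf'⟩ := Module.projective_lifting_property (LinearMap.range β).mkQ f
      (Submodule.mkQ_surjective _)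
    let α : U →ₗ[A] (Fin m → V) := LinearMap.fst A _ _ ∘ₗ (LinearMap.ker Ψ).subtype ∘ₗ f'
    let β' : U →ₗ[A] (Fin n → U) := LinearMap.snd A _ _ ∘ₗ (LinearMap.ker Ψ).subtype ∘ₗ f'
    have hαβ : ∀ x, Φ₀ (α x) + q (β' x) = 0 := fun x => (f' x).2
    choose s₁ s₂ hs using fun k => ha.exists_eq_add (LinearMap.proj k ∘ₗ α)
    have hs' : ∀ x, α x = (fun k => a (s₁ k x)) + fun k => s₂ k (a x) := fun x =>
      funext fun k => LinearMap.congr_fun (hs k) x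
    -- Splitting `α` as `a ∘ s₁ + s₂ ∘ a` turns the relation `Φ₀ α + q β' = 0` into the
    -- commutativity of this pair with `a` and `q`, so the pair factors through `Φ`.
    obtain ⟨ρ, ρ', hρ, e1, e2⟩ := hgen (β' + Φ₁ ∘ₗ LinearMap.pi s₁) (-(Φ₀ ∘ₗ LinearMap.pi s₂)) (by
      ext1 x
      have h1 := hαβ x
      have h2 := hΦ fun k => s₁ k x
      rw [hs', map_add, ← h2] at h1
      change q (β' x + Φ₁ fun k => s₁ k x) = -Φ₀ fun k => s₂ k (a x)
      rw [map_add, ← sub_eq_zero, ← h1]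
      abel)
    have e1' : ∀ x, β' x = Φ₁ (fun k => ρ k x) - Φ₁ fun k => s₁ k x := fun x => by
      have := LinearMap.congr_fun e1 x
      simp only [LinearMap.coe_sum, Finset.sum_apply, LinearMap.comp_apply] at this
      rw [hΦ₁ fun k => ρ k x, ← this]
      exact (add_sub_cancel_right _ _).symm
    have e2' : ∀ y, Φ₀ (fun k => s₂ k y + ρ' k y) = 0 := fun y => by
      have := LinearMap.congr_fun e2 y
      simp only [LinearMap.coe_sum, Finset.sum_apply, LinearMap.comp_apply] at this
      have h3 : Φ₀ (fun k => s₂ k y + ρ' k y) = Φ₀ (fun k => s₂ k y) + Φ₀ fun k => ρ' k y :=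
        map_add Φ₀ _ _
      rw [h3, hΦ₀ fun k => ρ' k y, ← this]
      exact add_neg_cancel _
    let g : V →ₗ[A] LinearMap.ker Ψ := LinearMap.codRestrict _
      (LinearMap.inl A _ _ ∘ₗ LinearMap.pi fun k => s₂ k + ρ' k) fun y => by
        rw [LinearMap.mem_ker]
        change Φ₀ (fun k => s₂ k y + ρ' k y) + q 0 = 0
        rw [e2', map_zero, add_zero]
    refine ⟨(LinearMap.range β).mkQ ∘ₗ g, ?_⟩
    rw [← hf']
    ext x
    simp only [LinearMap.comp_apply, Submodule.mkQ_apply]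
    refine ((Submodule.Quotient.eq (LinearMap.range β)).2 ⟨fun k => s₁ k x - ρ k x, Subtype.ext ?_⟩).symm
    rw [hβ]
    refine Prod.ext (funext fun k => ?_) ?_
    · change a (s₁ k x - ρ k x) = α x k - (s₂ k (a x) + ρ' k (a x))
      rw [map_sub, hs', show a (ρ k x) = ρ' k (a x) from LinearMap.congr_fun (hρ k) x]
      simp only [Pi.add_apply]
      abel
    · change -Φ₁ ((fun k => s₁ k x) - fun k => ρ k x) = β' x - 0
      rw [map_sub, e1']
      abel
  let f : (Fin n → U) →ₗ[A] LinearMap.ker Ψ :=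
    LinearMap.codRestrict _ (LinearMap.inr A _ _ - σ ∘ₗ q) fun x => by
      rw [LinearMap.mem_ker, LinearMap.sub_apply, map_sub]
      change Φ₀ 0 + q x - Ψ (σ (q x)) = 0
      rw [show Ψ (σ (q x)) = q x from LinearMap.congr_fun hσ _, map_zero, zero_add, sub_self]
  -- The class of `(0, x) - σ (q x)` in `ker Ψ / im β` is the obstruction to using `σ` as the
  -- homotopy. That quotient is in `𝒳`, so the obstruction extends along `q` and can be absorbed
  -- into the section.
  obtain ⟨g, hg⟩ := ha.exists_comp_extMap_eq h hH ((LinearMap.range β).mkQ ∘ₗ f)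
  obtain ⟨g', hg'⟩ := Module.projective_lifting_property (LinearMap.range β).mkQ g
    (Submodule.mkQ_surjective _)
  have h1 : ∀ x, (f - g' ∘ₗ q) x ∈ LinearMap.range β := fun x => by
    rw [← Submodule.Quotient.mk_eq_zero, LinearMap.sub_apply, Submodule.Quotient.mk_sub, sub_eq_zero]
    exact (LinearMap.congr_fun hg x).symm.trans (LinearMap.congr_fun hg' (q x)).symm
  obtain ⟨w, hw⟩ := Module.projective_lifting_property β.rangeRestrict
    (LinearMap.codRestrict _ _ h1) β.surjective_rangeRestrict
  -- The corrected section `τ` of `Ψ` satisfies `(0, x) - τ (q x) = β (w x)`. Its components are the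
  -- map back to the copies of `a` in degree `0` and the homotopy; `-w` is the map back in degree
  -- `-1`.
  let τ : B × (Fin n → V) →ₗ[A] (Fin m → V) × (Fin n → U) := σ + (LinearMap.ker Ψ).subtype ∘ₗ g'
  have hτ : ∀ y, Ψ (τ y) = y := fun y => by
    change Ψ (σ y + (g' y).1) = y
    rw [map_add, (g' y).2, add_zero]
    exact LinearMap.congr_fun hσ y
  have hτq : ∀ x, ((0, x) : (Fin m → V) × (Fin n → U)) - τ (q x) =
      (fun k => a (w x k), -Φ₁ (w x)) := fun x => by
    have h2 : β (w x) = f x - g' (q x) := congrArg Subtype.val (LinearMap.congr_fun hw x)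
    rw [← hβ, h2]
    change _ - (σ (q x) + (g' (q x)).1) = ((0, x) - σ (q x)) - (g' (q x)).1
    abel
  refine ⟨n, h, m, φ₁, φ₀, fun k => -(LinearMap.proj k ∘ₗ w),
    fun k => LinearMap.proj k ∘ₗ LinearMap.fst A _ _ ∘ₗ τ, LinearMap.snd A _ _ ∘ₗ τ, hφ, ?_, ?_, ?_⟩
  · intro k
    refine LinearMap.ext fun x => ?_
    have h2 := congrFun (congrArg Prod.fst (hτq x)) k
    change 0 - (τ (q x)).1 k = a (w x k) at h2
    change (τ (q x)).1 k = a (-(w x k))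
    rw [map_neg, ← h2]
    simp
  · intro x
    have h2 := congrArg Prod.snd (hτq x)
    change x - (τ (q x)).2 = -Φ₁ (w x) at h2
    change (τ (q x)).2 + ∑ k, φ₁ k (-(w x k)) = x
    simp only [map_neg, Finset.sum_neg_distrib]
    rw [← hΦ₁, ← h2]
    abel
  · intro y
    conv_rhs => rw [← hτ y]
    change q (τ y).2 + ∑ k, φ₀ k ((τ y).1 k) = Φ₀ (τ y).1 + q (τ y).2
    rw [hΦ₀, add_comm]

end Retract

section Transport

variable {A : Type u} [Ring A]

theorem IsTiltingMap.of_equiv {𝒳 𝒴 : ObjectProperty (ModuleCat.{u} A)}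
    {U V U' V' : Type u} [AddCommGroup U] [Module A U] [AddCommGroup V] [Module A V]
    [AddCommGroup U'] [Module A U'] [AddCommGroup V'] [Module A V']
    {a : U →ₗ[A] V} (ha : IsTiltingMap 𝒳 𝒴 a) (a' : U' →ₗ[A] V') (e₁ : U' ≃ₗ[A] U)
    (e₀ : V' ≃ₗ[A] V) (h : ∀ x, e₀ (a' x) = a (e₁ x)) : IsTiltingMap 𝒳 𝒴 a' := by
  have h' : ∀ x, a' (e₁.symm x) = e₀.symm (a x) := fun x => by
    rw [LinearEquiv.eq_symm_apply, h, LinearEquiv.apply_symm_apply]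
  refine ⟨fun M => (ha.left_iff M).trans (and_congr_right fun _ => ⟨fun H f => ?_, fun H f => ?_⟩),
    fun M => (ha.right_iff M).trans (and_congr_right fun _ => ⟨fun H g hg => ?_, fun H g hg => ?_⟩),
    fun t => ?_, fun g hg hg' => ?_, fun M hM N hN => ha.generates M hM N fun g hg => ?_⟩
  · obtain ⟨g, hg⟩ := H (f ∘ₗ e₁.symm.toLinearMap)
    refine ⟨g ∘ₗ e₀.toLinearMap, LinearMap.ext fun x => ?_⟩
    have := LinearMap.congr_fun hg (e₁ x)
    simpa [h] using this
  · obtain ⟨g, hg⟩ := H (f ∘ₗ e₁.toLinearMap)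
    refine ⟨g ∘ₗ e₀.symm.toLinearMap, LinearMap.ext fun x => ?_⟩
    have := LinearMap.congr_fun hg (e₁.symm x)
    simpa [h'] using this
  · have := H (g ∘ₗ e₀.symm.toLinearMap) (LinearMap.ext fun x => by
      simpa [h'] using LinearMap.congr_fun hg (e₁.symm x))
    ext x
    simpa using LinearMap.congr_fun this (e₀ x)
  · have := H (g ∘ₗ e₀.toLinearMap) (LinearMap.ext fun x => by
      simpa [h] using LinearMap.congr_fun hg (e₁ x))
    ext x
    simpa using LinearMap.congr_fun this (e₀.symm x)
  · obtain ⟨s, s', hs⟩ := ha.exists_eq_add (e₀.toLinearMap ∘ₗ t ∘ₗ e₁.symm.toLinearMap)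
    refine ⟨e₁.symm.toLinearMap ∘ₗ s ∘ₗ e₁.toLinearMap, e₀.symm.toLinearMap ∘ₗ s' ∘ₗ e₀.toLinearMap,
      LinearMap.ext fun x => e₀.injective ?_⟩
    simpa [h, h'] using LinearMap.congr_fun hs (e₁ x)
  · have := ha.eq_zero (e₁.toLinearMap ∘ₗ g ∘ₗ e₀.symm.toLinearMap)
      (LinearMap.ext fun x => by
        have := LinearMap.congr_fun hg (e₀.symm x)
        simp only [LinearMap.comp_apply, LinearEquiv.coe_coe, ← h, LinearMap.zero_apply] at this ⊢
        rw [this, map_zero])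
      (LinearMap.ext fun x => by
        have := LinearMap.congr_fun hg' (e₁.symm x)
        simp only [LinearMap.comp_apply, LinearEquiv.coe_coe, LinearMap.zero_apply] at this ⊢
        rw [← h', this, map_zero])
    ext x
    have h1 := LinearMap.congr_fun this (e₀ x)
    simpa using h1
  · have := hN (g ∘ₗ e₀.toLinearMap) (LinearMap.ext fun x => by
      simpa [h] using LinearMap.congr_fun hg (e₁ x))
    rwa [LinearMap.range_comp_of_range_eq_top _ e₀.range] at this

end Transport

/-! ### Morphisms in the derived and homotopy categories -/

section Derived

variable {A : Type u} [Ring A]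

open CochainComplex HomComplex

theorem forall_eq_zero_iff_of_bijective {G H : Type*} [AddGroup G] [AddGroup H] (f : G → H)
    (hf : Function.Bijective f) (h0 : f 0 = 0) : (∀ y : H, y = 0) ↔ ∀ x : G, x = 0 :=
  ⟨fun h x => hf.1 ((h _).trans h0.symm), fun h y => by
    obtain ⟨x, rfl⟩ := hf.2 y
    rw [h x, h0]⟩

theorem IsTwoTerm.isKProjective {P : Cpx A} (hP : IsTwoTerm P)
    (hproj : ∀ i, Module.Projective A (P.X i)) : P.IsKProjective := by
  have : P.IsStrictlyLE 0 := by
    rw [isStrictlyLE_iff]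
    exact fun i hi => hP i (by lia) (by lia)
  have : ∀ i, Projective (P.X i) := fun i =>
    (IsProjective.iff_projective (P.X i)).1 (hproj i)
  exact isKProjective_of_projective P 0

/-- K-projectivity lets derived morphisms be computed in the homotopy category, where they are
cocycles modulo coboundaries. -/
theorem forall_hom_singleFunctor_eq_zero_iff [HasDerivedCategory.{w} (ModuleCat.{u} A)] {P : Cpx A}
    [P.IsKProjective] (M : ModuleCat.{u} A) (n : ℤ) :
    (∀ f : DerivedCategory.Q.obj P ⟶
      ((DerivedCategory.singleFunctor (ModuleCat.{u} A) 0).obj M)⟦n⟧, f = 0) ↔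
    ∀ z : Cocycle P ((CochainComplex.singleFunctor _ 0).obj M) n, z ∈ coboundaries _ _ _ := by
  let L := (CochainComplex.singleFunctor (ModuleCat.{u} A) 0).obj M
  let e : ((DerivedCategory.singleFunctor (ModuleCat.{u} A) 0).obj M)⟦n⟧ ≅
      DerivedCategory.Q.obj (L⟦n⟧) :=
    (CategoryTheory.shiftFunctor _ n).mapIso ((DerivedCategory.singleFunctorIsoCompQ _ 0).app M) ≪≫
      ((DerivedCategory.Q.commShiftIso n).app L).symm
  let e' := (DerivedCategory.quotientCompQhIso (ModuleCat.{u} A)).app P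
  let e'' := (DerivedCategory.quotientCompQhIso (ModuleCat.{u} A)).app (L⟦n⟧)
  have h1 := (IsKProjective.Qh_map_bijective P
    ((HomotopyCategory.quotient _ _).obj (L⟦n⟧))).comp (CohomologyClass.toHom_bijective P L n)
  have h2 := (Iso.homCongr e' (e'' ≪≫ e.symm)).bijective.comp h1
  rw [forall_eq_zero_iff_of_bijective _ h2 (by simp)]
  constructor
  · intro h z
    rw [← CohomologyClass.mk_eq_zero_iff]
    exact h _
  · intro h z
    obtain ⟨z, rfl⟩ := z.mk_surjective
    rw [CohomologyClass.mk_eq_zero_iff]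
    exact h z

theorem IsTwoTerm.torsionClass_iff [HasDerivedCategory.{w} (ModuleCat.{u} A)] {P : Cpx A}
    (hP : IsTwoTerm P) (hproj : ∀ i, Module.Projective A (P.X i)) (M : ModuleCat.{u} A) :
    torsionClass P M ↔ Module.Finite A M ∧
      ∀ f : P.X (-1) →ₗ[A] M, ∃ g : P.X 0 →ₗ[A] M, g ∘ₗ (P.d (-1) 0).hom = f := by
  have := hP.isKProjective hproj
  refine and_congr_right fun _ => (forall_hom_singleFunctor_eq_zero_iff M 1).trans ?_
  have hz : IsZero (P.X (-2)) := hP _ (by lia) (by lia)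
  constructor
  · intro h f
    obtain ⟨g, hg⟩ := (Cocycle.toSingleMk_mem_coboundaries_iff (ModuleCat.ofHom f)
      (show (-1 : ℤ) + 1 = 0 by lia) (-2) (by lia) (hz.eq_of_src _ _) 0 (by lia)).1 (h _)
    exact ⟨g.hom, congrArg ModuleCat.Hom.hom hg⟩
  · intro h z
    obtain ⟨f, hf, rfl⟩ := Cocycle.toSingleMk_surjective z (-1) (by lia) (-2) (by lia)
    rw [Cocycle.toSingleMk_mem_coboundaries_iff _ _ _ _ _ 0 (by lia)]
    obtain ⟨g, hg⟩ := h f.hom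
    exact ⟨ModuleCat.ofHom g, ModuleCat.hom_ext hg⟩

theorem IsTwoTerm.torsionFreeClass_iff [HasDerivedCategory.{w} (ModuleCat.{u} A)] {P : Cpx A}
    (hP : IsTwoTerm P) (hproj : ∀ i, Module.Projective A (P.X i)) (M : ModuleCat.{u} A) :
    torsionFreeClass P M ↔ Module.Finite A M ∧
      ∀ g : P.X 0 →ₗ[A] M, g ∘ₗ (P.d (-1) 0).hom = 0 → g = 0 := by
  have := hP.isKProjective hproj
  refine and_congr_right fun _ => ?_
  have h0 := forall_hom_singleFunctor_eq_zero_iff (P := P) M 0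
  rw [← forall_eq_zero_iff_of_bijective _ (Iso.homCongr (Iso.refl (DerivedCategory.Q.obj P))
    ((shiftFunctorZero (DerivedCategory (ModuleCat.{u} A)) ℤ).app
      ((DerivedCategory.singleFunctor (ModuleCat.{u} A) 0).obj M))).bijective (by simp)] at h0
  refine h0.trans ?_
  have hz : IsZero (P.X 1) := hP _ (by lia) (by lia)
  constructor
  · intro h g hg
    obtain ⟨k, hk⟩ := (Cocycle.toSingleMk_mem_coboundaries_iff (ModuleCat.ofHom g)
      (show (0 : ℤ) + 0 = 0 by lia) (-1) (by lia) (ModuleCat.hom_ext hg) 1 (by lia)).1 (h _)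
    rw [hz.eq_of_src k 0, comp_zero] at hk
    exact (congrArg ModuleCat.Hom.hom hk).symm
  · intro h z
    obtain ⟨f, hf, rfl⟩ := Cocycle.toSingleMk_surjective z 0 (by lia) (-1) (by lia)
    rw [Cocycle.toSingleMk_mem_coboundaries_iff _ _ _ _ _ 1 (by lia)]
    exact ⟨0, by rw [comp_zero]; exact (ModuleCat.hom_ext (h f.hom
      (congrArg ModuleCat.Hom.hom hf))).symm⟩

/-- The vanishing of morphisms to shifts in the homotopy category. -/
theorem IsTwoTerm.hom_shift_eq_zero {P : Cpx A} (hP : IsTwoTerm P)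
    (h1 : ∀ t : P.X (-1) →ₗ[A] P.X 0, ∃ (s : P.X (-1) →ₗ[A] P.X (-1)) (s' : P.X 0 →ₗ[A] P.X 0),
      t = (P.d (-1) 0).hom ∘ₗ s + s' ∘ₗ (P.d (-1) 0).hom)
    (h2 : ∀ h : P.X 0 →ₗ[A] P.X (-1), (P.d (-1) 0).hom ∘ₗ h = 0 → h ∘ₗ (P.d (-1) 0).hom = 0 →
      h = 0) (i : ℤ) (hi : i ≠ 0) (f : toK P ⟶ (toK P)⟦i⟧) : f = 0 := by
  have key : ∀ z : Cocycle P P i, z ∈ coboundaries P P i := by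
    intro z
    by_cases hi1 : i = 1
    · subst hi1
      rw [mem_coboundaries_iff _ 0 (by lia)]
      obtain ⟨s, s', hs⟩ := h1 (z.1.v (-1) 0 (by lia)).hom
      -- The minus sign cancels the one in the differential of a degree `0` cochain.
      refine ⟨Cochain.single (p := -1) (q := -1) (ModuleCat.ofHom s) 0 -
        Cochain.single (p := 0) (q := 0) (ModuleCat.ofHom s') 0, ?_⟩
      ext p q hpq : 1
      by_cases hp : p = -1
      · obtain rfl : p = -1 := hp
        obtain rfl : q = 0 := by lia
        have e1 : (Cochain.single (p := 0) (q := 0) (ModuleCat.ofHom s') 0 : Cochain P P 0).v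
          (-1) (-1) (by lia) = 0 := Cochain.single_v_eq_zero _ _ _ _ _ (by lia)
        have e2 : (Cochain.single (p := -1) (q := -1) (ModuleCat.ofHom s) 0 : Cochain P P 0).v
          0 0 (by lia) = 0 := Cochain.single_v_eq_zero _ _ _ _ _ (by lia)
        rw [δ_v 0 1 (by lia) _ (-1) 0 hpq (-1) 0 (by lia) (by lia)]
        simp only [Cochain.sub_v, Cochain.single_v, e1, e2]
        apply ModuleCat.hom_ext
        erw [hs]
        simp
      · by_cases hp0 : p = 0
        · exact (hP q (by lia) (by lia)).eq_of_tgt _ _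
        · exact (hP p hp hp0).eq_of_src _ _
    · rw [mem_coboundaries_iff _ (i - 1) (by lia)]
      -- Outside degree `1` the cocycle itself is zero. Degree `0` being excluded, only `i = -1`
      -- leaves a component, from degree `0` to `-1`; the cocycle condition says that it is
      -- annihilated by the differential on both sides.
      refine ⟨0, ?_⟩
      rw [δ_zero]
      ext p q hpq : 1
      by_cases hp : p = -1
      · exact (hP q (by lia) (by lia)).eq_of_tgt _ _
      · by_cases hp0 : p = 0
        · by_cases hq : q = -1
          · subst hp0 hq
            obtain rfl : i = -1 := by lia
            have hz := z.δ_eq_zero 0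
            have e1 := Cochain.congr_v hz (-1) (-1) (by lia)
            have e2 := Cochain.congr_v hz 0 0 (by lia)
            rw [δ_v (-1) 0 (by lia) _ (-1) (-1) (by lia) (-2) 0 (by lia) (by lia),
              (hP (-2) (by lia) (by lia)).eq_of_tgt (z.1.v (-1) (-2) _) 0] at e1
            rw [δ_v (-1) 0 (by lia) _ 0 0 (by lia) (-1) 1 (by lia) (by lia),
              (hP 1 (by lia) (by lia)).eq_of_src (z.1.v 1 0 _) 0] at e2
            have := h2 (z.1.v 0 (-1) (by lia)).hom
              (by simpa using congrArg ModuleCat.Hom.hom e2)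
              (by simpa using congrArg ModuleCat.Hom.hom e1)
            exact (ModuleCat.hom_ext this).symm
          · exact (hP q hq (by lia)).eq_of_tgt _ _
        · exact (hP p hp hp0).eq_of_src _ _
  let e := ((HomotopyCategory.quotient (ModuleCat.{u} A) (ComplexShape.up ℤ)).commShiftIso i).app P
  have h3 : f ≫ e.inv = 0 := by
    obtain ⟨x, hx⟩ := (CohomologyClass.toHom_bijective P P i).2 (f ≫ e.inv)
    obtain ⟨z, rfl⟩ := x.mk_surjective
    rw [← hx, (CohomologyClass.mk_eq_zero_iff z).2 (key z), map_zero]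
  rw [← cancel_mono e.inv, h3, zero_comp]

end Derived

/-! ### Morphisms and homotopies of two-term complexes -/

section TwoTermHom

variable {A : Type u} [Ring A] {C D : Cpx A}

/-- The morphism between two-term complexes with given components. -/
noncomputable def twoTermHom (hC : IsTwoTerm C) (hD : IsTwoTerm D) (f : C.X (-1) ⟶ D.X (-1))
    (g : C.X 0 ⟶ D.X 0) (w : f ≫ D.d (-1) 0 = C.d (-1) 0 ≫ g) : C ⟶ D where
  f i := if h : i = -1 then by subst h; exact f else
    if h' : i = 0 then by subst h'; exact g else 0
  comm' i j hij := by
    change i + 1 = j at hij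
    by_cases h : i = -1
    · subst h
      obtain rfl : j = 0 := by lia
      simpa using w
    · by_cases h' : i = 0
      · exact (hD j (by lia) (by lia)).eq_of_tgt _ _
      · exact (hC i h h').eq_of_src _ _

@[simp]
theorem twoTermHom_f_neg_one (hC : IsTwoTerm C) (hD : IsTwoTerm D) (f : C.X (-1) ⟶ D.X (-1))
    (g : C.X 0 ⟶ D.X 0) (w : f ≫ D.d (-1) 0 = C.d (-1) 0 ≫ g) :
    (twoTermHom hC hD f g w).f (-1) = f := by
  simp [twoTermHom]

@[simp]
theorem twoTermHom_f_zero (hC : IsTwoTerm C) (hD : IsTwoTerm D) (f : C.X (-1) ⟶ D.X (-1))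
    (g : C.X 0 ⟶ D.X 0) (w : f ≫ D.d (-1) 0 = C.d (-1) 0 ≫ g) :
    (twoTermHom hC hD f g w).f 0 = g := by
  simp [twoTermHom]

theorem IsTwoTerm.hom_ext (hC : IsTwoTerm C) {f g : C ⟶ D} (h₁ : f.f (-1) = g.f (-1))
    (h₀ : f.f 0 = g.f 0) : f = g := by
  ext i : 1
  by_cases h : i = -1
  · subst h
    exact h₁
  · by_cases h' : i = 0
    · subst h'
      exact h₀
    · exact (hC i h h').eq_of_src _ _

theorem IsTwoTerm.quotient_map_eq_zero (hC : IsTwoTerm C) (φ : C ⟶ D)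
    (s : C.X 0 ⟶ D.X (-1)) (h₁ : φ.f (-1) = C.d (-1) 0 ≫ s) (h₀ : φ.f 0 = s ≫ D.d (-1) 0) :
    (HomotopyCategory.quotient (ModuleCat.{u} A) (ComplexShape.up ℤ)).map φ = 0 := by
  rw [HomotopyCategory.quotient_map_eq_zero_iff]
  let hom : ∀ i j : ℤ, C.X i ⟶ D.X j := fun i j =>
    if h : i = 0 then if h' : j = -1 then by subst h h'; exact s else 0 else 0
  have hom0 : hom 0 (-1) = s := by simp [hom]
  have hom' : ∀ i j, i ≠ 0 → hom i j = 0 := fun i j hi => dif_neg hi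
  have hom'' : ∀ i j, j ≠ -1 → hom i j = 0 := fun i j hj => by simp [hom, hj]
  refine ⟨⟨hom, fun i j hij => ?_, fun i => ?_⟩⟩
  · by_cases h : i = 0
    · subst h
      exact hom'' 0 j fun hj => hij (by simp [hj])
    · exact hom' i j h
  · rw [dNext_eq hom (show (ComplexShape.up ℤ).Rel i (i + 1) from rfl),
      prevD_eq hom (show (ComplexShape.up ℤ).Rel (i - 1) i by simp), HomologicalComplex.zero_f,
      add_zero]
    by_cases h : i = -1
    · subst h
      rw [hom' (-1) _ (by lia), zero_comp, add_zero, h₁]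
      exact congrArg _ hom0.symm
    · by_cases h' : i = 0
      · subst h'
        rw [hom' (0 + 1) _ (by lia), comp_zero, zero_add, h₀]
        exact congrArg (· ≫ D.d (-1) 0) hom0.symm
      · exact (hC i h h').eq_of_src _ _

/-- Homotopy retracts of sums of copies of `P` belong to `add P`. -/
theorem IsTwoTerm.inAdd {P : Cpx A} (hP : IsTwoTerm P) (hC : IsTwoTerm C) {m : ℕ}
    (c₁ : Fin m → (C.X (-1) ⟶ P.X (-1))) (c₀ : Fin m → (C.X 0 ⟶ P.X 0))
    (d₁ : Fin m → (P.X (-1) ⟶ C.X (-1))) (d₀ : Fin m → (P.X 0 ⟶ C.X 0))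
    (hc : ∀ k, c₁ k ≫ P.d (-1) 0 = C.d (-1) 0 ≫ c₀ k)
    (hd : ∀ k, d₁ k ≫ C.d (-1) 0 = P.d (-1) 0 ≫ d₀ k) (t : C.X 0 ⟶ C.X (-1))
    (h₁ : C.d (-1) 0 ≫ t + ∑ k, c₁ k ≫ d₁ k = 𝟙 _)
    (h₀ : t ≫ C.d (-1) 0 + ∑ k, c₀ k ≫ d₀ k = 𝟙 _) : InAdd (toK P) (toK C) := by
  let c := fun k => twoTermHom hC hP (c₁ k) (c₀ k) (hc k)
  let d := fun k => twoTermHom hP hC (d₁ k) (d₀ k) (hd k)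
  let F := HomotopyCategory.quotient (ModuleCat.{u} A) (ComplexShape.up ℤ)
  refine ⟨m, ⟨⟨biproduct.lift fun k => F.map (c k), biproduct.desc fun k => F.map (d k), ?_⟩⟩⟩
  rw [biproduct.lift_desc]
  simp only [← F.map_comp, ← F.map_sum]
  refine Eq.trans (sub_eq_zero.1 ?_).symm (F.map_id C)
  rw [← F.map_sub]
  refine hC.quotient_map_eq_zero _ t ?_ ?_
  · rw [← HomologicalComplex.Hom.fAddMonoidHom_apply, map_sub, map_sum]
    simp only [HomologicalComplex.Hom.fAddMonoidHom_apply, HomologicalComplex.id_f,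
      HomologicalComplex.comp_f, c, d, twoTermHom_f_neg_one]
    rw [← h₁, add_sub_cancel_right]
  · rw [← HomologicalComplex.Hom.fAddMonoidHom_apply, map_sub, map_sum]
    simp only [HomologicalComplex.Hom.fAddMonoidHom_apply, HomologicalComplex.id_f,
      HomologicalComplex.comp_f, c, d, twoTermHom_f_zero]
    rw [← h₀, add_sub_cancel_right]

end TwoTermHom

/-! ### Generation of the bounded homotopy category of projectives -/

section Generation

variable {A : Type u} [Ring A]

/-- Degreewise split short exact sequences give triangles in the homotopy category. -/
theorem of_degreewise_split (S : ObjectProperty (K A)) [S.IsClosedUnderIsomorphisms]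
    [S.IsTriangulated] (T : ShortComplex (Cpx A))
    (σ : ∀ n, Nonempty (T.map (HomologicalComplex.eval _ _ n)).Splitting) :
    (S (toK T.X₂) → S (toK T.X₃) → S (toK T.X₁)) ∧ (S (toK T.X₁) → S (toK T.X₃) → S (toK T.X₂)) := by
  have hT : CochainComplex.trianglehOfDegreewiseSplit T (fun n => (σ n).some) ∈ distTriang _ :=
    (HomotopyCategory.distinguished_iff_iso_trianglehOfDegreewiseSplit _).2 ⟨T, _, ⟨Iso.refl _⟩⟩
  exact ⟨fun h₂ h₃ => S.ext_of_isTriangulatedClosed₁ _ hT h₂ h₃,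
    fun h₁ h₃ => S.ext_of_isTriangulatedClosed₂ _ hT h₁ h₃⟩

/-- A splitting of a short complex of complexes in one degree. -/
theorem nonempty_eval_splitting {C₁ C₂ C₃ : Cpx A} (f : C₁ ⟶ C₂) (g : C₂ ⟶ C₃) (w : f ≫ g = 0)
    (i : ℤ) (r : C₂.X i ⟶ C₁.X i) (s : C₃.X i ⟶ C₂.X i) (h₁ : f.f i ≫ r = 𝟙 (C₁.X i))
    (h₃ : s ≫ g.f i = 𝟙 (C₃.X i)) (h₂ : r ≫ f.f i + g.f i ≫ s = 𝟙 (C₂.X i)) :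
    Nonempty ((ShortComplex.mk f g w).map (HomologicalComplex.eval _ _ i)).Splitting :=
  ⟨⟨r, s, h₁, h₃, h₂⟩⟩

/-- The two-term complex given by a linear map. -/
noncomputable abbrev twoTerm {U V : Type u} [AddCommGroup U] [Module A U] [AddCommGroup V]
    [Module A V] (a : U →ₗ[A] V) : Cpx A :=
  HomologicalComplex.double (ModuleCat.ofHom a) (show (ComplexShape.up ℤ).Rel (-1) 0 by simp)

section

variable {U V : Type u} [AddCommGroup U] [Module A U] [AddCommGroup V] [Module A V]

theorem isTwoTerm_twoTerm (a : U →ₗ[A] V) : IsTwoTerm (twoTerm a) := fun i h₁ h₀ =>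
  HomologicalComplex.isZero_double_X _ _ i h₁ h₀

/-- The component in degree `-1`. -/
noncomputable def twoTermIso₁ (a : U →ₗ[A] V) : (twoTerm a).X (-1) ≅ ModuleCat.of A U :=
  HomologicalComplex.doubleXIso₀ _ _

/-- The component in degree `0`. -/
noncomputable def twoTermIso₀ (a : U →ₗ[A] V) : (twoTerm a).X 0 ≅ ModuleCat.of A V :=
  HomologicalComplex.doubleXIso₁ _ _ (by lia)

theorem twoTerm_d (a : U →ₗ[A] V) : (twoTerm a).d (-1) 0 =
    (twoTermIso₁ a).hom ≫ ModuleCat.ofHom a ≫ (twoTermIso₀ a).inv :=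
  HomologicalComplex.double_d _ _ (by lia)

end

theorem inAdd_twoTerm {P : Cpx A} (hP : IsTwoTerm P) {U V : Type u} [AddCommGroup U] [Module A U]
    [AddCommGroup V] [Module A V] (q : U →ₗ[A] V) {m : ℕ}
    (φ₁ : Fin m → P.X (-1) →ₗ[A] U) (φ₀ : Fin m → P.X 0 →ₗ[A] V)
    (w : Fin m → U →ₗ[A] P.X (-1)) (s : Fin m → V →ₗ[A] P.X 0) (t : V →ₗ[A] U)
    (hφ : ∀ k, q ∘ₗ φ₁ k = φ₀ k ∘ₗ (P.d (-1) 0).hom)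
    (hs : ∀ k, s k ∘ₗ q = (P.d (-1) 0).hom ∘ₗ w k)
    (h₁ : ∀ x, t (q x) + ∑ k, φ₁ k (w k x) = x) (h₀ : ∀ y, q (t y) + ∑ k, φ₀ k (s k y) = y) :
    InAdd (toK P) (toK (twoTerm q)) := by
  refine hP.inAdd (isTwoTerm_twoTerm q) (fun k => (twoTermIso₁ q).hom ≫ ModuleCat.ofHom (w k))
    (fun k => (twoTermIso₀ q).hom ≫ ModuleCat.ofHom (s k))
    (fun k => ModuleCat.ofHom (φ₁ k) ≫ (twoTermIso₁ q).inv)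
    (fun k => ModuleCat.ofHom (φ₀ k) ≫ (twoTermIso₀ q).inv) (fun k => ?_) (fun k => ?_)
    ((twoTermIso₀ q).hom ≫ ModuleCat.ofHom t ≫ (twoTermIso₁ q).inv) ?_ ?_
  · have : ModuleCat.ofHom (w k) ≫ P.d (-1) 0 = ModuleCat.ofHom q ≫ ModuleCat.ofHom (s k) :=
      ModuleCat.hom_ext (hs k).symm
    simp [twoTerm_d, this]
  · have : ModuleCat.ofHom (φ₁ k) ≫ ModuleCat.ofHom q = P.d (-1) 0 ≫ ModuleCat.ofHom (φ₀ k) :=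
      ModuleCat.hom_ext (hφ k)
    simp only [twoTerm_d, Category.assoc, Iso.inv_hom_id_assoc]
    rw [← Category.assoc, this, Category.assoc]
  · have : ModuleCat.ofHom q ≫ ModuleCat.ofHom t +
        ∑ k, ModuleCat.ofHom (w k) ≫ ModuleCat.ofHom (φ₁ k) = 𝟙 _ := by
      ext x
      simpa [ModuleCat.hom_sum] using h₁ x
    have h2 := congrArg (fun z => (twoTermIso₁ q).hom ≫ z ≫ (twoTermIso₁ q).inv) this
    simpa [twoTerm_d, Preadditive.comp_add, Preadditive.add_comp, Preadditive.comp_sum,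
      Preadditive.sum_comp] using h2
  · have : ModuleCat.ofHom t ≫ ModuleCat.ofHom q +
        ∑ k, ModuleCat.ofHom (s k) ≫ ModuleCat.ofHom (φ₀ k) = 𝟙 _ := by
      ext x
      simpa [ModuleCat.hom_sum] using h₀ x
    have h2 := congrArg (fun z => (twoTermIso₀ q).hom ≫ z ≫ (twoTermIso₀ q).inv) this
    simpa [twoTerm_d, Preadditive.comp_add, Preadditive.add_comp, Preadditive.comp_sum,
      Preadditive.sum_comp] using h2

/-- A module belongs to a triangulated subcategory containing an extension of it by copies of `a`
and the sum of these copies. -/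
theorem single_of_extMap (S : ObjectProperty (K A)) [S.IsClosedUnderIsomorphisms]
    [S.IsTriangulated] {U V B : Type u} [AddCommGroup U] [Module A U] [AddCommGroup V] [Module A V]
    [AddCommGroup B] [Module A B] (a : U →ₗ[A] V) {n : ℕ} (h : Fin n → U →ₗ[A] B)
    (hq : S (toK (twoTerm (extMap a h))))
    (hp : S (toK (twoTerm (LinearMap.pi fun k : Fin n => a ∘ₗ LinearMap.proj k)))) :
    S (toK ((CochainComplex.singleFunctor _ 0).obj (ModuleCat.of A B))) := by
  let q := extMap a h
  let p := LinearMap.pi fun k : Fin n => a ∘ₗ LinearMap.proj (R := A) (φ := fun _ => U) k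
  let L : Cpx A := (CochainComplex.singleFunctor _ 0).obj (ModuleCat.of A B)
  have hL' : ∀ i, i ≠ 0 → IsZero (L.X i) := fun i hi =>
    HomologicalComplex.isZero_single_obj_X (ComplexShape.up ℤ) 0 (ModuleCat.of A B) i hi
  have hL : IsTwoTerm L := fun i _ hi => hL' i hi
  let e : L.X 0 ≅ ModuleCat.of A B := HomologicalComplex.singleObjXSelf (ComplexShape.up ℤ) 0 _
  let f : L ⟶ twoTerm q := twoTermHom hL (isTwoTerm_twoTerm q) 0
    (e.hom ≫ ModuleCat.ofHom (LinearMap.inl A _ _) ≫ (twoTermIso₀ q).inv)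
    ((hL' (-1) (by lia)).eq_of_src _ _)
  have hqp : ModuleCat.ofHom q ≫ ModuleCat.ofHom (LinearMap.snd A B (Fin n → V)) =
      ModuleCat.ofHom p := rfl
  let g : twoTerm q ⟶ twoTerm p := twoTermHom (isTwoTerm_twoTerm q) (isTwoTerm_twoTerm p)
    ((twoTermIso₁ q).hom ≫ (twoTermIso₁ p).inv)
    ((twoTermIso₀ q).hom ≫ ModuleCat.ofHom (LinearMap.snd A _ _) ≫ (twoTermIso₀ p).inv) (by
      simp only [twoTerm_d, Category.assoc, Iso.inv_hom_id_assoc]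
      rw [← hqp]
      simp)
  have hfg : f ≫ g = 0 := by
    refine hL.hom_ext ((hL' (-1) (by lia)).eq_of_src _ _) ?_
    have : ModuleCat.ofHom (LinearMap.inl A B (Fin n → V)) ≫
        ModuleCat.ofHom (LinearMap.snd A _ _) = 0 := rfl
    simp [f, g, reassoc_of% this]
  -- The sequence from `B` through `q` to the copies of `a` splits in each degree; the maps `h k`
  -- only affect the differential.
  refine (of_degreewise_split S (ShortComplex.mk f g hfg) fun i => ?_).1 hq hp
  by_cases h1 : i = -1
  · subst h1
    refine nonempty_eval_splitting f g hfg _ 0 ((twoTermIso₁ p).hom ≫ (twoTermIso₁ q).inv)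
      ((hL' (-1) (by lia)).eq_of_src _ _) ?_ ?_
    · simp [g]
    · simp [g]
  · by_cases h0 : i = 0
    · subst h0
      refine nonempty_eval_splitting f g hfg _
        ((twoTermIso₀ q).hom ≫ ModuleCat.ofHom (LinearMap.fst A _ _) ≫ e.inv)
        ((twoTermIso₀ p).hom ≫ ModuleCat.ofHom (LinearMap.inr A _ _) ≫ (twoTermIso₀ q).inv)
        ?_ ?_ ?_
      · have : ModuleCat.ofHom (LinearMap.inl A B (Fin n → V)) ≫
          ModuleCat.ofHom (LinearMap.fst A _ _) = 𝟙 _ := rfl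
        simp [f, reassoc_of% this]
      · have : ModuleCat.ofHom (LinearMap.inr A B (Fin n → V)) ≫
          ModuleCat.ofHom (LinearMap.snd A _ _) = 𝟙 _ := rfl
        simp [g, reassoc_of% this]
      · have : ModuleCat.ofHom (LinearMap.fst A B (Fin n → V)) ≫
            ModuleCat.ofHom (LinearMap.inl A _ _) + ModuleCat.ofHom (LinearMap.snd A _ _) ≫
            ModuleCat.ofHom (LinearMap.inr A _ _) = 𝟙 _ := by
          ext x <;> simp
        have h2 := congrArg (fun z => (twoTermIso₀ q).hom ≫ z ≫ (twoTermIso₀ q).inv) this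
        simpa [f, g, Preadditive.comp_add, Preadditive.add_comp] using h2
    · exact nonempty_eval_splitting f g hfg _ 0 0 ((hL i h1 h0).eq_of_src _ _)
        ((isTwoTerm_twoTerm p i h1 h0).eq_of_src _ _) ((isTwoTerm_twoTerm q i h1 h0).eq_of_src _ _)

end Generation

section Generation

variable {A : Type u} [Ring A]

theorem single_of_single_zero (S : ObjectProperty (K A)) [S.IsClosedUnderIsomorphisms]
    [S.IsTriangulated] {B : ModuleCat.{u} A}
    (h : S (toK ((CochainComplex.singleFunctor _ 0).obj B))) (b : ℤ) :
    S (toK ((CochainComplex.singleFunctor _ b).obj B)) :=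
  S.prop_of_iso (((HomotopyCategory.singleFunctors (ModuleCat.{u} A)).shiftIso (-b) b 0
    (by lia)).app B) (S.le_shift (-b) _ h)

/-- A full triangulated subcategory containing the finitely generated projective modules contains
the bounded complexes of finitely generated projective modules. -/
theorem toK_of_single (S : ObjectProperty (K A)) [S.IsClosedUnderIsomorphisms]
    [S.IsTriangulated]
    (h : ∀ B : ModuleCat.{u} A, Module.Finite A B → Module.Projective A B →
      S (toK ((CochainComplex.singleFunctor _ 0).obj B))) (n : ℕ) :
    ∀ (a : ℤ) (Q : Cpx A), (∀ i : ℤ, i < a ∨ a + n ≤ i → IsZero (Q.X i)) →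
      (∀ i : ℤ, Module.Finite A (Q.X i) ∧ Module.Projective A (Q.X i)) → S (toK Q) := by
  induction n with
  | zero =>
    intro a Q hQ _
    have h0 : IsZero Q := by
      rw [IsZero.iff_id_eq_zero]
      ext i : 1
      exact (hQ i (by lia)).eq_of_src _ _
    exact S.prop_of_isZero ((HomotopyCategory.quotient _ _).map_isZero h0)
  | succ n ih =>
    intro a Q hQ hproj
    -- The top term is a subcomplex because nothing follows it; the quotient has one term less.
    let f : (CochainComplex.singleFunctor _ (a + n)).obj (Q.X (a + n)) ⟶ Q :=
      HomologicalComplex.mkHomFromSingle (𝟙 _) fun k hk => by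
        change a + n + 1 = k at hk
        exact (hQ k (by lia)).eq_of_tgt _ _
    have hf : IsIso (f.f (a + n)) := by
      have : f.f (a + n) = (HomologicalComplex.singleObjXSelf (ComplexShape.up ℤ) _ _).hom :=
        (HomologicalComplex.mkHomFromSingle_f _ _).trans (Category.comp_id _)
      rw [this]
      exact Iso.isIso_hom _
    have hz : ∀ i, i ≠ a + n →
        IsZero (((CochainComplex.singleFunctor _ (a + n)).obj (Q.X (a + n))).X i) := fun i hi =>
      HomologicalComplex.isZero_single_obj_X (ComplexShape.up ℤ) _ _ i hi
    have hmono : ∀ i, Mono (f.f i) := fun i => by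
      by_cases hi : i = a + n
      · subst hi
        infer_instance
      · exact ⟨fun _ _ _ => (hz i hi).eq_of_tgt _ _⟩
    have : Mono f := HomologicalComplex.mono_of_mono_f f hmono
    let T : ShortComplex (Cpx A) := ShortComplex.mk f (cokernel.π f) (cokernel.condition f)
    have hT : T.ShortExact :=
      { exact := ShortComplex.exact_cokernel f
        mono_f := this
        epi_g := inferInstanceAs (Epi (cokernel.π f)) }
    have hTi : ∀ i, (T.map (HomologicalComplex.eval _ _ i)).ShortExact := fun i =>
      hT.map_of_exact _
    have h0 : IsZero (T.X₃.X (a + n)) := by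
      have := (hTi (a + n)).isIso_f_iff.1 hf
      exact this
    have hiso : ∀ i, i ≠ a + n → Nonempty (Q.X i ≅ T.X₃.X i) := fun i hi => by
      have : IsIso (T.g.f i) := (hTi i).isIso_g_iff.2 (hz i hi)
      exact ⟨asIso (T.g.f i)⟩
    have hproj' : ∀ i, Module.Finite A (T.X₃.X i) ∧ Module.Projective A (T.X₃.X i) := fun i => by
      by_cases hi : i = a + n
      · subst hi
        have := ModuleCat.subsingleton_of_isZero h0
        exact ⟨inferInstance, inferInstance⟩
      · obtain ⟨e⟩ := hiso i hi
        have := (hproj i).1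
        have := (hproj i).2
        exact ⟨Module.Finite.equiv e.toLinearEquiv, Module.Projective.of_equiv e.toLinearEquiv⟩
    refine (of_degreewise_split S T fun i => ?_).2
      (single_of_single_zero S (h _ (hproj _).1 (hproj _).2) _) (ih a _ (fun i hi => ?_) hproj')
    · have := (IsProjective.iff_projective (R := A) (T.X₃.X i)).1 (hproj' i).2
      have : Projective ((T.map (HomologicalComplex.eval _ _ i)).X₃) := this
      exact ⟨(hTi i).splittingOfProjective⟩
    · by_cases hi' : i = a + n
      · subst hi'
        exact h0
      · obtain ⟨e⟩ := hiso i hi'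
        exact (hQ i (by push_cast; lia)).of_iso e.symm

/-- The additive closure of a two-term complex of finitely generated projective modules
generates all bounded complexes of finitely generated projective modules when its differential is
a tilting map. -/
theorem IsTiltingMap.toK_of_inAdd (R : Type*) [CommRing R] [IsNoetherianRing R] [Algebra R A]
    [Module.Finite R A] [IsNoetherianRing A] {𝒳 𝒴 : ObjectProperty (ModuleCat.{u} A)} {P : Cpx A}
    (hP : IsTwoTerm P)
    (hproj : ∀ i : ℤ, Module.Finite A (P.X i) ∧ Module.Projective A (P.X i))
    (hd : IsTiltingMap 𝒳 𝒴 (P.d (-1) 0).hom) (S : ObjectProperty (K A))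
    [S.IsClosedUnderIsomorphisms] [S.IsTriangulated] (hS : ∀ T, InAdd (toK P) T → S T)
    (Q : Cpx A) (hQ : IsBoundedProj Q) : S (toK Q) := by
  obtain ⟨⟨a, b, hab⟩, hQproj⟩ := hQ
  -- When `b + 1 < a` the truncation to `0` is harmless, as then all terms vanish.
  refine toK_of_single S (fun B hB hB' => ?_) (b + 1 - a).toNat a Q
    (fun i hi => hab i (by lia)) hQproj
  have := hproj (-1) |>.1
  have := hproj (-1) |>.2
  have := hproj 0 |>.1
  have := hproj 0 |>.2
  obtain ⟨n, h, m, φ₁, φ₀, w, s, t, e₁, e₂, e₃, e₄⟩ := hd.exists_retract (B := B) R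
  refine single_of_extMap S (P.d (-1) 0).hom h
    (hS _ (inAdd_twoTerm hP _ φ₁ φ₀ w s t e₁ e₂ e₃ e₄)) (hS _ ?_)
  -- The sum of `n` copies of the differential is a strict retract, so the homotopy is `0`.
  refine inAdd_twoTerm hP _ (fun k => LinearMap.single A (fun _ => P.X (-1)) k)
    (fun k => LinearMap.single A (fun _ => P.X 0) k) (fun k => LinearMap.proj k)
    (fun k => LinearMap.proj k) 0 (fun k => ?_) (fun k => rfl) (fun x => ?_) (fun y => ?_)
  · ext x j
    by_cases hj : j = k
    · subst hj
      simp
    · simp [hj]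
  · simp [Finset.univ_sum_single]
  · simp [Finset.univ_sum_single]

end Generation

/-! ### Finiteness of projective covers -/

section Covers

variable {A : Type u} [Ring A] {M N : Type u} [AddCommGroup M] [Module A M]
  [AddCommGroup N] [Module A N]

/-- Lifts of generators of `N` span `M` together with the superfluous kernel, hence on their own. -/
theorem IsProjectiveCover.finite [Module.Finite A N] {p : M →ₗ[A] N} (hp : IsProjectiveCover p) :
    Module.Finite A M := by
  obtain ⟨n, s, hs⟩ := Module.Finite.exists_fin (R := A) (M := N)
  choose t ht using fun k => hp.2.1 (s k)
  refine ⟨Submodule.fg_def.2 ⟨Set.range t, Set.finite_range t, hp.2.2 _ ?_⟩⟩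
  have hst : p '' Set.range t = Set.range s := by
    rw [← Set.range_comp]
    exact congrArg Set.range (funext ht)
  rw [← Submodule.comap_map_eq, Submodule.map_span, hst, hs, Submodule.comap_top]

end Covers

section Complexes

variable {A : Type u} [Ring A]

/-- The terms of a biproduct of complexes of modules. -/
noncomputable def biprodXEquiv (C D : Cpx A) (i : ℤ) : (C ⊞ D).X i ≃ₗ[A] C.X i × D.X i :=
  LinearEquiv.ofLinearMap
    (((biprod.fst : C ⊞ D ⟶ C).f i).hom.prod ((biprod.snd : C ⊞ D ⟶ D).f i).hom)
    (((biprod.inl : C ⟶ C ⊞ D).f i).hom.coprod ((biprod.inr : D ⟶ C ⊞ D).f i).hom)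
    (by
      have h₁ := congrArg ModuleCat.Hom.hom (HomologicalComplex.biprod_inl_fst_f C D i)
      have h₂ := congrArg ModuleCat.Hom.hom (HomologicalComplex.biprod_inl_snd_f C D i)
      have h₃ := congrArg ModuleCat.Hom.hom (HomologicalComplex.biprod_inr_fst_f C D i)
      have h₄ := congrArg ModuleCat.Hom.hom (HomologicalComplex.biprod_inr_snd_f C D i)
      simp only [ModuleCat.hom_comp, ModuleCat.hom_id, ModuleCat.hom_zero] at h₁ h₂ h₃ h₄
      ext x
      · simpa using LinearMap.congr_fun h₁ x
      · simpa using LinearMap.congr_fun h₂ x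
      · simpa using LinearMap.congr_fun h₃ x
      · simpa using LinearMap.congr_fun h₄ x)
    (by
      have h : (biprod.fst : C ⊞ D ⟶ C).f i ≫ (biprod.inl : C ⟶ C ⊞ D).f i +
          (biprod.snd : C ⊞ D ⟶ D).f i ≫ (biprod.inr : D ⟶ C ⊞ D).f i = 𝟙 _ := by
        rw [← HomologicalComplex.comp_f, ← HomologicalComplex.comp_f,
          ← HomologicalComplex.add_f_apply, biprod.total, HomologicalComplex.id_f]
      exact congrArg ModuleCat.Hom.hom h)

theorem biprodXEquiv_d (C D : Cpx A) (i j : ℤ) (x : (C ⊞ D).X i) :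
    biprodXEquiv C D j ((C ⊞ D).d i j x) =
      (C.d i j).hom.prodMap (D.d i j).hom (biprodXEquiv C D i x) := by
  have h₁ := congrArg ModuleCat.Hom.hom ((biprod.fst : C ⊞ D ⟶ C).comm i j)
  have h₂ := congrArg ModuleCat.Hom.hom ((biprod.snd : C ⊞ D ⟶ D).comm i j)
  exact Prod.ext (LinearMap.congr_fun h₁ x).symm (LinearMap.congr_fun h₂ x).symm

end Complexes

/-! ### The terms and the differential of the presentation complex -/

section PresentationComplex

variable {R A I : Type u} [CommRing R] [Ring A] [Algebra R A] [AddCommGroup I] [Module R I]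
  {P₁ P₀ E₀ E₁ : ModuleCat.{u} A}

theorem isTwoTerm_presentationComplex (d : P₁ ⟶ P₀) (δ : E₀ ⟶ E₁) :
    IsTwoTerm (presentationComplex R A I d δ) := fun i h₁ h₀ => by
  refine IsZero.of_iso ?_ (HomologicalComplex.biprodXIso _ _ i)
  refine (biprod_isZero_iff _ _).2 ⟨HomologicalComplex.isZero_double_X _ _ i h₁ h₀, ?_⟩
  exact (dualHom R A I).map_isZero
    (HomologicalComplex.isZero_double_X _ _ (i + 1) (by lia) (by lia))

/-- The component of `presentationComplex` in degree `-1`. -/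
noncomputable def presentationEquiv₁ (d : P₁ ⟶ P₀) (δ : E₀ ⟶ E₁) :
    (presentationComplex R A I d δ).X (-1) ≃ₗ[A] P₁ × (Dual R A I →ₗ[A] E₀) :=
  biprodXEquiv _ _ (-1) ≪≫ₗ LinearEquiv.prodCongr
    (HomologicalComplex.doubleXIso₀ _ _).toLinearEquiv
    (((dualHom R A I).mapIso (HomologicalComplex.doubleXIso₀ δ
      (show (ComplexShape.up ℤ).Rel 0 1 by simp))).toLinearEquiv ≪≫ₗ LinearEquiv.neg A)

/-- The component of `presentationComplex` in degree `0`. -/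
noncomputable def presentationEquiv₀ (d : P₁ ⟶ P₀) (δ : E₀ ⟶ E₁) :
    (presentationComplex R A I d δ).X 0 ≃ₗ[A] P₀ × (Dual R A I →ₗ[A] E₁) :=
  biprodXEquiv _ _ 0 ≪≫ₗ LinearEquiv.prodCongr
    (HomologicalComplex.doubleXIso₁ _ _ (by lia)).toLinearEquiv
    ((dualHom R A I).mapIso (HomologicalComplex.doubleXIso₁ δ
      (show (ComplexShape.up ℤ).Rel 0 1 by simp) (by lia))).toLinearEquiv

/-- The shift by one negates the differential; the sign built into `presentationEquiv₁` compensates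
for this. -/
theorem presentationEquiv_d (d : P₁ ⟶ P₀) (δ : E₀ ⟶ E₁)
    (x : (presentationComplex R A I d δ).X (-1)) :
    presentationEquiv₀ d δ (((presentationComplex R A I d δ).d (-1) 0).hom x) =
      d.hom.prodMap (dualHomMap (R := R) (I := I) δ.hom) (presentationEquiv₁ d δ x) := by
  have h := biprodXEquiv_d (HomologicalComplex.double d
      (show (ComplexShape.up ℤ).Rel (-1) 0 by simp) : Cpx A)
    ((((dualHom R A I).mapHomologicalComplex (ComplexShape.up ℤ)).obj
      (HomologicalComplex.double δ (show (ComplexShape.up ℤ).Rel 0 1 by simp)) : Cpx A)⟦(1 : ℤ)⟧)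
    (-1) 0 x
  have h₁ : (HomologicalComplex.double d
      (show (ComplexShape.up ℤ).Rel (-1) 0 by simp) : Cpx A).d (-1) 0 ≫
      (HomologicalComplex.doubleXIso₁ d _ (by lia)).hom =
      (HomologicalComplex.doubleXIso₀ d _).hom ≫ d := by
    rw [HomologicalComplex.double_d _ _ (by lia)]
    simp
  have h₂ : (HomologicalComplex.double δ
      (show (ComplexShape.up ℤ).Rel 0 1 by simp) : Cpx A).d 0 1 ≫
      (HomologicalComplex.doubleXIso₁ δ _ (by lia)).hom =
      (HomologicalComplex.doubleXIso₀ δ _).hom ≫ δ := by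
    rw [HomologicalComplex.double_d _ _ (by lia)]
    simp
  have h₃ : ((((dualHom R A I).mapHomologicalComplex (ComplexShape.up ℤ)).obj
      (HomologicalComplex.double δ
        (show (ComplexShape.up ℤ).Rel 0 1 by simp)) : Cpx A)⟦(1 : ℤ)⟧).d (-1) 0 =
      -(dualHom R A I).map ((HomologicalComplex.double δ
        (show (ComplexShape.up ℤ).Rel 0 1 by simp) : Cpx A).d 0 1) := by
    rw [CochainComplex.shiftFunctor_obj_d', Int.negOnePow_one, Units.neg_smul, one_smul]
    rfl
  have h₄ := congrArg (dualHom R A I).map h₂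
  rw [Functor.map_comp, Functor.map_comp] at h₄
  replace h₁ := congrArg ModuleCat.Hom.hom h₁
  replace h₃ := congrArg ModuleCat.Hom.hom h₃
  replace h₄ := congrArg ModuleCat.Hom.hom h₄
  change LinearEquiv.prodCongr _ _ (biprodXEquiv _ _ 0 _) = _
  refine (congrArg _ h).trans ?_
  rw [h₃]
  refine Prod.ext (LinearMap.congr_fun h₁ _) ?_
  refine (LinearMap.map_neg ((dualHom R A I).map (HomologicalComplex.doubleXIso₁ δ
    (show (ComplexShape.up ℤ).Rel 0 1 by simp) (by lia)).hom).hom _).trans ?_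
  refine (congrArg Neg.neg (LinearMap.congr_fun h₄ _)).trans ?_
  exact (map_neg (dualHomMap (R := R) (I := I) δ.hom) _).symm

end PresentationComplex

end ArtinTilting

theorem theorem5p8 {R A I : Type u} [CommRing R] [IsArtinianRing R] [Ring A] [Algebra R A]
    [Module.Finite R A] [AddCommGroup I] [Module R I]
    (ι : (R ⧸ Ring.jacobson R) →ₗ[R] I) (hι : ArtinTilting.IsInjectiveEnvelope ι)
    [HasDerivedCategory.{w} (ModuleCat.{u} A)]
    (𝒳 𝒴 : ObjectProperty (ModuleCat.{u} A)) (h𝒳𝒴 : ArtinTilting.IsTorsionTheory 𝒳 𝒴)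
    (X Y : ModuleCat.{u} A)
    (hX : ArtinTilting.IsExtProjective 𝒳 X) (hXgen : ArtinTilting.Generates X 𝒳)
    (hY : ArtinTilting.IsExtInjective 𝒴 Y) (hYcogen : ArtinTilting.Cogenerates Y 𝒴)
    (hstable : ∀ M, 𝒳 M → 𝒳 (ArtinTilting.dualTensor R A I M))
    {P₁ P₀ E₀ E₁ : ModuleCat.{u} A} (d : P₁ ⟶ P₀) (ε : P₀ ⟶ X)
    (hd : ArtinTilting.IsMinimalProjectivePresentation d ε)
    (η : Y ⟶ E₀) (δ : E₀ ⟶ E₁) (hδ : ArtinTilting.IsMinimalInjectivePresentation η δ) :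
    ArtinTilting.IsTwoTerm (ArtinTilting.presentationComplex R A I d δ) ∧
      ArtinTilting.IsTiltingComplex (ArtinTilting.presentationComplex R A I d δ) ∧
      𝒳 = ArtinTilting.torsionClass (ArtinTilting.presentationComplex R A I d δ) ∧
      𝒴 = ArtinTilting.torsionFreeClass (ArtinTilting.presentationComplex R A I d δ) := by
  have hA : IsNoetherianRing A := IsNoetherianRing.of_finite R A
  have hXf := h𝒳𝒴.finite_left X hX.1
  have hYf := h𝒳𝒴.finite_right Y hY.1
  have hP₀f : Module.Finite A P₀ := hd.1.finite
  have hP₁f : Module.Finite A P₁ := hd.2.2.finite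
  obtain ⟨D₀⟩ := hι.nonempty_dualSummand (A := A) η.hom hδ.1
  -- Finiteness of `E₀` passes to `E₀ / Im η`, whose envelope `E₁` is therefore a summand of a power
  -- of `DA` too.
  have hE₀f := D₀.finite hι
  obtain ⟨D₁⟩ := hι.nonempty_dualSummand (A := A) _ hδ.2.2
  have hP₁ : Module.Projective A P₁ := hd.2.2.1
  have hP₀ : Module.Projective A P₀ := hd.1.1
  have := D₀.finite_dualHom hι
  have := D₁.finite_dualHom hι
  have := D₀.projective_dualHom hι
  have := D₁.projective_dualHom hι
  have hP := ArtinTilting.isTwoTerm_presentationComplex (R := R) (I := I) d δ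
  have ha := (h𝒳𝒴.isTiltingMap_prodMap hι hX hXgen hY hYcogen hstable D₀ D₁ hd hδ).of_equiv _ _ _
    (ArtinTilting.presentationEquiv_d d δ)
  have hproj : ∀ i : ℤ, Module.Finite A ((ArtinTilting.presentationComplex R A I d δ).X i) ∧
      Module.Projective A ((ArtinTilting.presentationComplex R A I d δ).X i) := fun i => by
    by_cases h₁ : i = -1
    · subst h₁
      exact ⟨Module.Finite.equiv (ArtinTilting.presentationEquiv₁ d δ).symm,
        Module.Projective.of_equiv (ArtinTilting.presentationEquiv₁ d δ).symm⟩
    · by_cases h₀ : i = 0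
      · subst h₀
        exact ⟨Module.Finite.equiv (ArtinTilting.presentationEquiv₀ d δ).symm,
          Module.Projective.of_equiv (ArtinTilting.presentationEquiv₀ d δ).symm⟩
      · have := ModuleCat.subsingleton_of_isZero (hP i h₁ h₀)
        exact ⟨inferInstance, inferInstance⟩
  refine ⟨hP, ⟨⟨⟨-1, 0, fun i hi => hP i (by lia) (by lia)⟩, hproj⟩,
    hP.hom_shift_eq_zero ha.exists_eq_add ha.eq_zero, fun S _ _ hS Q hQ =>
      ha.toK_of_inAdd R hP hproj S hS Q hQ⟩, ?_, ?_⟩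
  · ext M
    rw [ha.left_iff, hP.torsionClass_iff fun i => (hproj i).2]
  · ext M
    rw [ha.right_iff, hP.torsionFreeClass_iff fun i => (hproj i).2]
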